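/- Consider a sequence, indexed by $r\in\mathbb N$, of parallel server systems with a finite set $\mathcal I$ of server pools and a finite set $\mathcal J$ of customer classes, all on one probability space. Write $\mathcal J(i)$ for the classes that pool $i$ can serve and $\mathcal I(j)$ for the pools that can serve class $j$. In the $r$-th system pool $i$ has $N^r_i$ servers, $|N^r|=\sum_iN^r_i$, and class $j$ has arrival rate $\lambda^r_j\ge 0$. Vectors, matrices and tuples carry the maximum norm $|\cdot|$, and $\|x\|_L=\sup_{0\le t\le L}|x(t)|$. *Primitives (the same for all $r$).* For each $j$, let $\chi_j$ be a delayed renewal process: its interarrival times $u_j(1),u_j(2),\dots$ are independent and nonnegative, those with $l\ge2$ are identically distributed with mean $1$ and $\mathbb E\,u_j(2)^{2+\delta}<\infty$ for some $\delta>0$, and the delay $u_j(1)$ has arbitrary law. Let $S_{ijk}$ ($i\in\mathcal I$, $j\in\mathcal J$, $k\ge1$) be i.i.d. standard Poisson processes. For $j\in\mathcal J(i)$ the random service rates $\mu_{ijk}$, $k\ge1$, are i.i.d. with values in $[p_{ij},q_{ij}]$, $p_{ij}>0$, and mean $\bar\mu_{ij}$. Let $V_{ijk}(m)=\sum_{l=1}^m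 v_{ijk}(l)/\mu_{ijk}$, where $v_{ijk}(l)$ are the times between successive jumps of $S_{ijk}$. *Dynamics.* Let $A^r_j(t)=\chi_j(\lambda^r_jt)$. Let $B^r_{ijk}(t)\in\{0,1\}$ indicate that server $k\le N^r_i$ of pool $i$ is serving class $j$ (each server serves at most one customer at a time), and put $$T^r_{ijk}(t)=\int_0^tB^r_{ijk}(s)\,ds,\quad D^r_{ijk}(t)=S_{ijk}(\mu_{ijk}T^r_{ijk}(t)),\quad (Z^r_{ij},T^r_{ij},D^r_{ij})=\sum_{k\le N^r_i}(B^r_{ijk},T^r_{ijk},D^r_{ijk}).$$ The queue lengths $Q^r_j$ and the nondecreasing counting processes $A^r_{qj}$ (delayed arrivals), $A^r_{sij}$ (arrivals starting service at once in pool $i$) and $C^r_{ij}$ (delayed customers who have started service in pool $i$) take values in the nonnegative integers; together with $B^r$ they have right-continuous paths with left limits; $A^r_{sij},C^r_{ij},B^r_{ijk}$ vanish for $j\notin\mathcal J(i)$. Almost surely, for all $t\ge0$, $$A^r_j=A^r_{qj}+\sum_{i\in\mathcal I(j)}A^r_{sij},\quad Q^r_j=Q^r_j(0)+A^r_{qj}-\sum_{i\in\mathcal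 I(j)}C^r_{ij},\quad Z^r_{ij}=Z^r_{ij}(0)+A^r_{sij}+C^r_{ij}-D^r_{ij},$$ $$Q^r_j(t)\sum_{i\in\mathcal I(j)}\Big(N^r_i-\sum_{j'\in\mathcal J(i)}Z^r_{ij'}(t)\Big)=0,\qquad \int_0^t\sum_{i\in\mathcal I(j)}\Big(N^r_i-\sum_{j'\in\mathcal J(i)}Z^r_{ij'}(s-)\Big)dA^r_{qj}(s)=0 .$$ The control policy is otherwise arbitrary but nonanticipating: for each $r$ there is a $\sigma$-algebra $\mathcal G^r$, independent of $(S_{ijk})$, with respect to which the rates $\mu_{ijk}$, the interarrival times and the initial state $Q^r(0),B^r(0)$ are measurable, such that for all $t\ge0$ and $\tau_{ijk}\ge0$ the event $\{\mu_{ijk}T^r_{ijk}(t)\le\tau_{ijk}\ \forall i,j,\ k\le N^r_i\}$ belongs to $\mathcal G^r\vee\sigma(S_{ijk}(s):s\le\tau_{ijk},\ i\in\mathcal I,\ j\in\mathcal J,\ k\le N^r_i)$. *Asymptotics.* As $r\to\infty$: $\lambda^r_j\to\infty$, $\lambda^r_j/|N^r|\to\lambda_j\in(0,\infty)$ and $N^r_i/|N^r|\to\beta_i>0$.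 Let $(\rho^*,x^*)$ be an optimal solution of the static planning problem: minimise $\rho$ subject to $\sum_{i\in\mathcal I(j)}\beta_i\bar\mu_{ij}x_{ij}=\lambda_j$ for all $j$, $\sum_{j\in\mathcal J(i)}x_{ij}\le\rho$ for all $i$, $x\ge0$ (and $x_{ij}=0$ if $j\notin\mathcal J(i)$). *Hydrodynamic scaling.* For $m\in\{0,1,2,\dots\}$ put $$x_{r,m}=\Big|\big(Z^r_{ij}(m/\sqrt{|N^r|})-x^*_{ij}N^r_i\big)_{i,j}\Big|^2\vee|N^r|,\qquad \theta_{r,m}(t)=\frac{\sqrt{x_{r,m}}\,t}{|N^r|}+\frac m{\sqrt{|N^r|}} .$$ For $X=A,A_s,A_q,C,T,D,D_{ijk}$ put $X^{r,m}(t)=x_{r,m}^{-1/2}\big(X^r(\theta_{r,m}(t))-X^r(\theta_{r,m}(0))\big)$. Further, let $Q^{r,m}(t)=x_{r,m}^{-1/2}Q^r(\theta_{r,m}(t))$, $B^{r,m}_{ijk}(t)=x_{r,m}^{-1/2}(B^r_{ijk}(\theta_{r,m}(t))-x^*_{ij})$, $Z^{r,m}_{ij}(t)=x_{r,m}^{-1/2}(Z^r_{ij}(\theta_{r,m}(t))-N^r_ix^*_{ij})$,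 and, for $b=(b_1,b_2)$, $$V^{r,m}_{ijk}(D^{r,m}_{ijk}(t),b)=x_{r,m}^{-1/2}\Big(V_{ijk}\big(D^r_{ijk}(\theta_{r,m}(t))+b_1\big)-V_{ijk}\big(D^r_{ijk}(\theta_{r,m}(0))+b_2\big)\Big).$$ Let $\mathbb X^{r,m}=(A,A_s,A_q,Q,B,Z,C,T,D)^{r,m}$. **Proposition.** There is a constant $N\in(0,\infty)$, depending only on $\mathcal I$, $\mathcal J$, the sets $\mathcal J(i)$, and on $\beta$, $\lambda$, $q$, such that for every such sequence of systems and all $\epsilon,L,T>0$ the following hold for all sufficiently large $r$: 1. $\displaystyle P\Big\{\max_{m<\sqrt{|N^r|}T}\Big\|A^{r,m}(t)-\frac{\lambda^r}{|N^r|}t\Big\|_L>\epsilon\Big\}\le\epsilon$; 2. the probability that there are $m<\sqrt{|N^r|}T$ and $t_1,t_2\in[0,L]$ with $|D^{r,m}(t_2)-D^{r,m}(t_1)|>N|t_2-t_1|+\epsilon$ is at most $\epsilon$; 3. $\displaystyle P\Big\{\max_{m<\sqrt{|N^r|}T}\Big\|V^{r,m}_{ijk}(D^{r,m}_{ijk}(t),b)-\frac1{\mu_{ijk}}D^{r,m}_{ijk}(t)\Big\|_L>\epsilon\Big\}\le\epsilon$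 for all $i\in\mathcal I$, $j\in\mathcal J(i)$, $k\le N^r_i$ and $b\in\{(1,0),(0,1)\}$; 4. the probability that there are $m<\sqrt{|N^r|}T$ and $0\le t_1\le t_2\le L$ with $|\mathbb X^{r,m}(t_2)-\mathbb X^{r,m}(t_1)|>N|t_2-t_1|+\epsilon$ is at most $\epsilon$. -/

import Mathlib

open MeasureTheory ProbabilityTheory Filter Topology
open scoped NNReal ENNReal

noncomputable section

namespace RandomServer

/-! ### Primitive processes -/

/-- Right-continuity with left limits, for integer-valued paths on `[0, ∞)`. -/
structure IsCadlag (f : ℝ≥0 → ℕ) : Prop where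
  right_cont : ∀ t, ContinuousWithinAt f (Set.Ici t) t
  left_lim : ∀ t, ∃ l, Tendsto f (𝓝[<] t) (𝓝 l)

/-- A standard (unit rate) Poisson process. The paths are nondecreasing, so the subtraction
of natural numbers in the increments is never truncated. -/
structure IsStdPoissonProcess {Ω : Type*} [MeasurableSpace Ω] (P : Measure Ω)
    (S : ℝ≥0 → Ω → ℕ) : Prop where
  measurable : ∀ t, Measurable (S t)
  zero : ∀ ω, S 0 ω = 0
  mono : ∀ ω, Monotone fun t => S t ω
  cadlag : ∀ ω, IsCadlag fun t => S t ω
  indep : HasIndepIncrements S P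
  law : ∀ s h : ℝ≥0, P.map (fun ω => S (s + h) ω - S s ω) = poissonMeasure h

/-- The time of the `m`-th jump of a counting process `S` (equal to `0` for `m = 0`). -/
def jumpTime {Ω : Type*} (S : ℝ≥0 → Ω → ℕ) (m : ℕ) (ω : Ω) : ℝ≥0 :=
  sInf {t : ℝ≥0 | m ≤ S t ω}

/-- The time between the `l`-th and the `(l+1)`-st jump of a counting process `S`. -/
def interJumpTime {Ω : Type*} (S : ℝ≥0 → Ω → ℕ) (l : ℕ) (ω : Ω) : ℝ :=
  (jumpTime S (l + 1) ω : ℝ) - jumpTime S l ω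

/-- `u 0` is the delay (of arbitrary law), `u 1, u 2, …` are the interarrival times of a
delayed renewal process with rate one whose interarrival times have a moment of some order
larger than two. -/
structure IsDelayedRenewalSequence {Ω : Type*} [MeasurableSpace Ω] (P : Measure Ω)
    (u : ℕ → Ω → ℝ) : Prop where
  measurable : ∀ l, Measurable (u l)
  nonneg : ∀ l, ∀ᵐ ω ∂P, 0 ≤ u l ω
  indep : iIndepFun u P
  ident : ∀ l, 1 ≤ l → IdentDistrib (u l) (u 1) P P
  mean : ∫ ω, u 1 ω ∂P = 1
  moment : ∃ δ : ℝ, 0 < δ ∧ MemLp (u 1) (ENNReal.ofReal (2 + δ)) P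

/-- The renewal process `χ(t) = max {m : u(1) + ⋯ + u(m) ≤ t}`. -/
def renewalCount {Ω : Type*} (u : ℕ → Ω → ℝ) (t : ℝ≥0) (ω : Ω) : ℕ :=
  sSup {m : ℕ | ∑ l ∈ Finset.range m, u l ω ≤ t}

/-! ### Sequences of systems -/

/-- The data of a sequence of systems with set of server pools `I` and set of customer
classes `J`, all living on one probability space. Servers of a pool are numbered from `0`.
The renewal processes, the potential service processes and the service rates do not change
along the sequence. -/
structure SystemSeq (I J Ω : Type*) where
  /-- `n r i`: the number of servers of pool `i` in the `r`-th system -/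
  n : ℕ → I → ℕ
  /-- `rate r j`: the arrival rate of class `j` in the `r`-th system -/
  rate : ℕ → J → ℝ≥0
  /-- the interarrival times of the unit rate renewal processes -/
  u : J → ℕ → Ω → ℝ
  /-- the potential service processes -/
  S : I → J → ℕ → ℝ≥0 → Ω → ℕ
  /-- the random service rates -/
  μ : I → J → ℕ → Ω → ℝ
  /-- arrivals that have to wait in the queue -/
  Aq : ℕ → J → ℝ≥0 → Ω → ℕ
  /-- arrivals that start service in the given pool on arrival -/
  As : ℕ → I → J → ℝ≥0 → Ω → ℕ
  /-- delayed customers who have started service in the given pool -/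
  C : ℕ → I → J → ℝ≥0 → Ω → ℕ
  /-- queue lengths -/
  Q : ℕ → J → ℝ≥0 → Ω → ℕ
  /-- busy indicators of the single servers -/
  B : (r : ℕ) → (i : I) → J → Fin (n r i) → ℝ≥0 → Ω → ℕ

namespace SystemSeq

variable {I J Ω : Type*} (X : SystemSeq I J Ω)

/-- The total number of servers in the `r`-th system. -/
def total [Fintype I] (r : ℕ) : ℕ := ∑ i, X.n r i

/-- `A`: the arrival processes. -/
def A (r : ℕ) (j : J) (t : ℝ≥0) (ω : Ω) : ℕ := renewalCount (X.u j) (X.rate r j * t) ω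

/-- `T_{ijk}(t) = ∫₀ᵗ B_{ijk}(s) ds`. -/
def serverT (r : ℕ) (i : I) (j : J) (k : Fin (X.n r i)) (t : ℝ≥0) (ω : Ω) : ℝ :=
  ∫ s in (0 : ℝ)..t, (X.B r i j k s.toNNReal ω : ℝ)

/-- `D_{ijk}(t) = S_{ijk}(μ_{ijk} T_{ijk}(t))`. -/
def serverD (r : ℕ) (i : I) (j : J) (k : Fin (X.n r i)) (t : ℝ≥0) (ω : Ω) : ℕ :=
  X.S i j k (X.μ i j k ω * X.serverT r i j k t ω).toNNReal ω

/-- `Z_{ij}`: the number of servers of pool `i` busy with class `j`. -/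
def Z (r : ℕ) (i : I) (j : J) (t : ℝ≥0) (ω : Ω) : ℕ := ∑ k, X.B r i j k t ω

/-- `T_{ij}`: the total time spent by pool `i` on class `j`. -/
def T (r : ℕ) (i : I) (j : J) (t : ℝ≥0) (ω : Ω) : ℝ := ∑ k, X.serverT r i j k t ω

/-- `D_{ij}`: the departures of class `j` from pool `i`. -/
def D (r : ℕ) (i : I) (j : J) (t : ℝ≥0) (ω : Ω) : ℕ := ∑ k, X.serverD r i j k t ω

/-- The cumulative service time process `V_{ijk}(m) = ∑_{l ≤ m} v_{ijk}(l) / μ_{ijk}`, where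
`v_{ijk}(1), v_{ijk}(2), …` are the times between the jumps of `S_{ijk}`. -/
def V (i : I) (j : J) (k : ℕ) (m : ℕ) (ω : Ω) : ℝ :=
  ∑ l ∈ Finset.range m, interJumpTime (X.S i j k) l ω / X.μ i j k ω

/-- The number of idle servers of pool `i`. -/
def idle [Fintype J] (r : ℕ) (i : I) (t : ℝ≥0) (ω : Ω) : ℤ :=
  (X.n r i : ℤ) - ∑ j, (X.Z r i j t ω : ℤ)

/-- What the paths of the `r`-th system satisfy; `skill i j` says that pool `i` can serve
class `j`. -/
structure IsPath [Fintype I] [Fintype J] (skill : I → J → Prop) (r : ℕ) (ω : Ω) : Prop where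
  cadlag_Aq : ∀ j, IsCadlag fun t => X.Aq r j t ω
  cadlag_As : ∀ i j, IsCadlag fun t => X.As r i j t ω
  cadlag_C : ∀ i j, IsCadlag fun t => X.C r i j t ω
  cadlag_Q : ∀ j, IsCadlag fun t => X.Q r j t ω
  cadlag_B : ∀ i j k, IsCadlag fun t => X.B r i j k t ω
  mono_Aq : ∀ j, Monotone fun t => X.Aq r j t ω
  mono_As : ∀ i j, Monotone fun t => X.As r i j t ω
  mono_C : ∀ i j, Monotone fun t => X.C r i j t ω
  /-- every server is busy with at most one customer -/
  busy_le_one : ∀ i k t, ∑ j, X.B r i j k t ω ≤ 1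
  /-- customers are served by capable pools only -/
  skill_B : ∀ i j k t, ¬ skill i j → X.B r i j k t ω = 0
  skill_As : ∀ i j t, ¬ skill i j → X.As r i j t ω = 0
  skill_C : ∀ i j t, ¬ skill i j → X.C r i j t ω = 0
  arrivals : ∀ j t, X.A r j t ω = X.Aq r j t ω + ∑ i, X.As r i j t ω
  queue : ∀ j t, X.Q r j t ω + ∑ i, X.C r i j t ω = X.Q r j 0 ω + X.Aq r j t ω
  busy : ∀ i j t,
    X.Z r i j t ω + X.D r i j t ω = X.Z r i j 0 ω + X.As r i j t ω + X.C r i j t ω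
  /-- customers wait only if all capable servers are busy -/
  non_idling : ∀ i j t, skill i j → (X.Q r j t ω : ℤ) * X.idle r i t ω = 0
  /-- `∫ ∑_{i ∈ I(j)} idle_i(s-) dA_{qj}(s) = 0`: the integrand is nonnegative and `A_{qj}` is a
  counting process, so the integral vanishes if and only if the integrand vanishes at every
  jump. -/
  delayed : ∀ i j (t : ℝ≥0), 0 < t → skill i j →
    Function.leftLim (fun s => X.Aq r j s ω) t < X.Aq r j t ω →
    Function.leftLim (fun s => X.idle r i s ω) t = 0

/-- The control of the `r`-th system is nonanticipating: there is a σ-algebra `𝒢` of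
information that is independent of the potential service processes (initial state, service
rates, arrivals, randomisation of the control) such that the event that every `S_{ijk}` has been
used by time `t` up to `τ_{ijk}` at most is determined by `𝒢` and the restrictions of the
`S_{ijk}` to `[0, τ_{ijk}]`. -/
def NonAnticipating [mΩ : MeasurableSpace Ω] (P : Measure Ω) (r : ℕ) : Prop :=
  ∃ 𝒢 : MeasurableSpace Ω, 𝒢 ≤ mΩ ∧
    Indep 𝒢 (⨆ (i : I) (j : J) (k : ℕ) (s : ℝ≥0), MeasurableSpace.comap (X.S i j k s) ⊤) P ∧
    (∀ i j k, Measurable[𝒢] (X.μ i j k)) ∧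
    (∀ j l, Measurable[𝒢] (X.u j l)) ∧
    (∀ j, Measurable[𝒢] (X.Q r j 0)) ∧
    (∀ i j k, Measurable[𝒢] (X.B r i j k 0)) ∧
    ∀ (t : ℝ≥0) (τ : I → J → ℕ → ℝ≥0),
      MeasurableSet[𝒢 ⊔ ⨆ (i : I) (j : J) (k : Fin (X.n r i)) (s : ℝ≥0) (_ : s ≤ τ i j k),
          MeasurableSpace.comap (X.S i j k s) ⊤]
        {ω | ∀ i j (k : Fin (X.n r i)), X.μ i j k ω * X.serverT r i j k t ω ≤ τ i j k}

/-- A sequence of parallel random server systems: `skill i j` says that pool `i` can serve class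
`j`, and the random service rates then lie in `[p i j, q i j]`. The scheduling policy is any
nonanticipating, non-idling one. -/
structure IsParallelRandomServer [Fintype I] [Fintype J] [MeasurableSpace Ω]
    (skill : I → J → Prop) (p q : I → J → ℝ) (P : Measure Ω) : Prop where
  /-- arrivals -/
  renewal : ∀ j, IsDelayedRenewalSequence P (X.u j)
  rate_atTop : ∀ j, Tendsto (fun r => (X.rate r j : ℝ)) atTop atTop
  /-- potential services: i.i.d. standard Poisson processes -/
  poisson : ∀ i j k, IsStdPoissonProcess P (X.S i j k)
  poisson_indep : iIndepFun (fun (a : I × J × ℕ) (ω : Ω) (t : ℝ≥0) => X.S a.1 a.2.1 a.2.2 t ω) P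
  /-- service rates: bounded, and i.i.d. within a pool, for every class -/
  p_pos : ∀ i j, skill i j → 0 < p i j
  μ_meas : ∀ i j k, Measurable (X.μ i j k)
  μ_mem : ∀ i j k, skill i j → ∀ᵐ ω ∂P, X.μ i j k ω ∈ Set.Icc (p i j) (q i j)
  μ_indep : ∀ i j, skill i j → iIndepFun (fun k => X.μ i j k) P
  μ_ident : ∀ i j k, skill i j → IdentDistrib (X.μ i j k) (X.μ i j 0) P P
  /-- the processes -/
  meas_Aq : ∀ r j t, Measurable (X.Aq r j t)
  meas_As : ∀ r i j t, Measurable (X.As r i j t)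
  meas_C : ∀ r i j t, Measurable (X.C r i j t)
  meas_Q : ∀ r j t, Measurable (X.Q r j t)
  meas_B : ∀ r i j k t, Measurable (X.B r i j k t)
  path : ∀ r, ∀ᵐ ω ∂P, X.IsPath skill r ω
  nonanticipating : ∀ r, X.NonAnticipating P r

/-! ### Hydrodynamic scaling -/

section Scaling

variable [Fintype I] [Fintype J] (xs : I → J → ℝ) (r m : ℕ)

/-- The scaling factor `x_{r,m} = |Z^r(m/√|N^r|) - x* N^r|² ∨ |N^r|`, with the maximum norm. -/
def scaleFactor (ω : Ω) : ℝ :=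
  max (‖fun (i : I) (j : J) =>
      (X.Z r i j (m / √(X.total r : ℝ)).toNNReal ω : ℝ) - xs i j * X.n r i‖ ^ 2)
    (X.total r)

/-- The time `√x_{r,m} t / |N^r| + m / √|N^r|`. -/
def scaledTime (ω : Ω) (t : ℝ) : ℝ≥0 :=
  (√(X.scaleFactor xs r m ω) * t / X.total r + m / √(X.total r : ℝ)).toNNReal

/-- The scaled increment `(F(√x_{r,m} t / |N^r| + m / √|N^r|) - F(m / √|N^r|)) / √x_{r,m}`. -/
def hydro (F : ℝ≥0 → Ω → ℝ) (t : ℝ) (ω : Ω) : ℝ :=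
  (F (X.scaledTime xs r m ω t) ω - F (m / √(X.total r : ℝ)).toNNReal ω) /
    √(X.scaleFactor xs r m ω)

/-- `A^{r,m}` -/
def hydroA (t : ℝ) (ω : Ω) : J → ℝ := fun j => X.hydro xs r m (fun s ω => X.A r j s ω) t ω

/-- `A_s^{r,m}` -/
def hydroAs (t : ℝ) (ω : Ω) : I → J → ℝ := fun i j =>
  X.hydro xs r m (fun s ω => X.As r i j s ω) t ω

/-- `A_q^{r,m}` -/
def hydroAq (t : ℝ) (ω : Ω) : J → ℝ := fun j => X.hydro xs r m (fun s ω => X.Aq r j s ω) t ω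

/-- `C^{r,m}` -/
def hydroC (t : ℝ) (ω : Ω) : I → J → ℝ := fun i j =>
  X.hydro xs r m (fun s ω => X.C r i j s ω) t ω

/-- `T^{r,m}` -/
def hydroT (t : ℝ) (ω : Ω) : I → J → ℝ := fun i j => X.hydro xs r m (X.T r i j) t ω

/-- `D^{r,m}` -/
def hydroD (t : ℝ) (ω : Ω) : I → J → ℝ := fun i j =>
  X.hydro xs r m (fun s ω => X.D r i j s ω) t ω

/-- `D_{ijk}^{r,m}` -/
def hydroServerD (i : I) (j : J) (k : Fin (X.n r i)) (t : ℝ) (ω : Ω) : ℝ :=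
  X.hydro xs r m (fun s ω => X.serverD r i j k s ω) t ω

/-- `Q^{r,m}` -/
def hydroQ (t : ℝ) (ω : Ω) : J → ℝ := fun j =>
  X.Q r j (X.scaledTime xs r m ω t) ω / √(X.scaleFactor xs r m ω)

/-- `B^{r,m}` -/
def hydroB (t : ℝ) (ω : Ω) : (i : I) → J → Fin (X.n r i) → ℝ := fun i j k =>
  (X.B r i j k (X.scaledTime xs r m ω t) ω - xs i j) / √(X.scaleFactor xs r m ω)

/-- `Z^{r,m}` -/
def hydroZ (t : ℝ) (ω : Ω) : I → J → ℝ := fun i j =>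
  (X.Z r i j (X.scaledTime xs r m ω t) ω - X.n r i * xs i j) / √(X.scaleFactor xs r m ω)

/-- `V_{ijk}^{r,m}(D_{ijk}^{r,m}(t), b)` -/
def hydroV (i : I) (j : J) (k : Fin (X.n r i)) (b : ℕ × ℕ) (t : ℝ) (ω : Ω) : ℝ :=
  (X.V i j k (X.serverD r i j k (X.scaledTime xs r m ω t) ω + b.1) ω -
    X.V i j k (X.serverD r i j k (m / √(X.total r : ℝ)).toNNReal ω + b.2) ω) /
    √(X.scaleFactor xs r m ω)

/-- The hydrodynamically scaled process
`𝕏^{r,m} = (A, A_s, A_q, Q, B, Z, C, T, D)^{r,m}`; its values carry the maximum norm. -/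
def hydroX (t : ℝ) (ω : Ω) :
    (J → ℝ) × (I → J → ℝ) × (J → ℝ) × (J → ℝ) × ((i : I) → J → Fin (X.n r i) → ℝ) ×
      (I → J → ℝ) × (I → J → ℝ) × (I → J → ℝ) × (I → J → ℝ) :=
  (X.hydroA xs r m t ω, X.hydroAs xs r m t ω, X.hydroAq xs r m t ω, X.hydroQ xs r m t ω,
    X.hydroB xs r m t ω, X.hydroZ xs r m t ω, X.hydroC xs r m t ω, X.hydroT xs r m t ω,
    X.hydroD xs r m t ω)

end Scaling

end SystemSeq

/-! ### The static planning problem -/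

open scoped Classical in
/-- `(ρ, x)` is feasible for the static planning problem with pool proportions `β`, mean service
rates `μbar` and arrival rates `lam`; the variables of incapable pairs are set to zero. -/
structure IsFeasible {I J : Type*} [Fintype I] [Fintype J] (skill : I → J → Prop) (β : I → ℝ)
    (μbar : I → J → ℝ) (lam : J → ℝ) (ρ : ℝ) (x : I → J → ℝ) : Prop where
  demand : ∀ j, ∑ i with skill i j, β i * μbar i j * x i j = lam j
  load : ∀ i, ∑ j with skill i j, x i j ≤ ρ
  nonneg : ∀ i j, 0 ≤ x i j
  incapable : ∀ i j, ¬ skill i j → x i j = 0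

/-- `(ρ, x)` is an optimal solution of the static planning problem, which minimises `ρ`. -/
def IsOptimal {I J : Type*} [Fintype I] [Fintype J] (skill : I → J → Prop) (β : I → ℝ)
    (μbar : I → J → ℝ) (lam : J → ℝ) (ρ : ℝ) (x : I → J → ℝ) : Prop :=
  IsFeasible skill β μbar lam ρ x ∧
    ∀ ρ' x', IsFeasible skill β μbar lam ρ' x' → ρ ≤ ρ'

end RandomServer

end

noncomputable section

namespace RandomServer

/-! ### Independence of the past and the future of a family of Poisson processes -/

section Independence

variable {Ω : Type*} {mΩ : MeasurableSpace Ω} {P : Measure Ω}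

/-! Write n for the total number of servers. Claims 1, 2 and 4 are deterministic consequences of one
event, `IsRegularPath`, whose probability tends to 1 (`tendsto_measure_not_isRegularPath`):
uniformly over s ≤ t in a fixed interval [0, K], arrivals deviate from their rate by at most a small
multiple of rate · (t - s) plus e√n, and departures grow by at most a constant times n(t - s) plus
e√n. Since n ≤ x_{r,m} and √x_{r,m} ≤ (1 + |x*|) n, every scaled window lies in [0, K]. Its length
is √x_{r,m} Δt / n, so slopes of order n become constants after division by √x_{r,m}, while e√n
becomes at most e. Hence all m are treated at once.

Arrivals (`tendsto_measure_sum_deviation`): interarrival times are truncated at n^α with 1/(2+δ) < α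
< 1/2. The moment of order 2+δ makes truncation unlikely to matter, and a Chernoff bound survives
the union over all O(n²) blocks of partial sums. The estimate is then inverted to one for the
counting process.

Departures (`tendsto_measure_D_deviation`): by nonanticipation, the vector of clocks μT of all
servers is a multi-parameter stopping time for the Poisson processes. A strong Markov property
(`measure_stopped_increments_le`) bounds the departures from a pool during a short time by a sum of
independent Poisson variables; Chernoff and a grid of mesh of order 1/√n do the rest.

The other components inherit these bounds. The decisive one is C (`C_sub_le`): at the left end of an
interval, non-idling leaves either an empty queue, so that entries into service are paid for by
arrivals, or a full pool, so that they are paid for by departures. Balance equations then give Q and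
Z.

Claim 3 concerns one server at a time, which has only a tight number of jumps up to time K; dividing
by √n makes everything negligible. -/

theorem indep_sup_iSup_of_iIndep {ι : Type*} [Fintype ι] {m p f : ι → MeasurableSpace Ω}
    {G : MeasurableSpace Ω} (hG : G ≤ mΩ) (hm : ∀ k, m k ≤ mΩ) (hp : ∀ k, p k ≤ m k)
    (hf : ∀ k, f k ≤ m k) (him : iIndep m P) (hGm : Indep G (⨆ k, m k) P)
    (hpf : ∀ k, Indep (p k) (f k) P) : Indep (G ⊔ ⨆ k, p k) (⨆ k, f k) P := by
  classical
  let M : (Unit ⊕ ι) ⊕ ι → MeasurableSpace Ω :=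
    Sum.elim (Sum.elim (fun _ => G) p) f
  have hM : iIndep M P := by
    rw [iIndep_iff]
    intro s A hA
    let A' : (Unit ⊕ ι) ⊕ ι → Set Ω := fun i => if i ∈ s then A i else Set.univ
    have hA' : ∀ i, MeasurableSet[M i] (A' i) := by
      intro i
      by_cases h : i ∈ s
      · simpa [A', h] using hA i h
      · simp only [A', h, if_false]
        exact MeasurableSet.univ
    -- Past and future events of the same index k are paired. Each pair lies in `m k`, so the three
    -- independence assumptions apply in turn: `G` against everything, then across k, then past
    -- against future within k.
    have h1 : (⋂ i ∈ s, A i) = A' (.inl (.inl ())) ∩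
        ⋂ k, (A' (.inl (.inr k)) ∩ A' (.inr k)) := by
      have : (⋂ i ∈ s, A i) = ⋂ i, A' i := by
        ext ω
        simp only [Set.mem_iInter, A']
        refine forall_congr' fun i => ?_
        by_cases h : i ∈ s <;> simp [h]
      rw [this]
      ext ω
      simp only [Set.mem_iInter, Set.mem_inter_iff, Sum.forall]
      constructor
      · rintro ⟨⟨h1, h2⟩, h3⟩
        exact ⟨h1 (), fun k => ⟨h2 k, h3 k⟩⟩
      · rintro ⟨h1, h2⟩
        exact ⟨⟨fun _ => h1, fun k => (h2 k).1⟩, fun k => (h2 k).2⟩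
    have h2 : ∏ i ∈ s, P (A i) = ∏ i, P (A' i) := by
      have := him.isProbabilityMeasure
      rw [← Finset.prod_subset (Finset.subset_univ s)]
      · exact Finset.prod_congr rfl fun i hi => by simp [A', hi]
      · intro i _ hi
        simp [A', hi]
    have h3 : ∀ k, MeasurableSet[m k] (A' (.inl (.inr k)) ∩ A' (.inr k)) := fun k =>
      MeasurableSet.inter (hp k _ (hA' (.inl (.inr k)))) (hf k _ (hA' (.inr k)))
    rw [h1, h2, (Indep_iff _ _ _).1 hGm _ _ (hA' (.inl (.inl ())))
      (MeasurableSet.iInter fun k => le_iSup m k _ (h3 k)), him.meas_iInter h3]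
    rw [Fintype.prod_sum_type, Fintype.prod_sum_type, mul_assoc, ← Finset.prod_mul_distrib]
    congr 1
    · simp
    · exact Finset.prod_congr rfl fun k _ =>
        (Indep_iff _ _ _).1 (hpf k) _ _ (hA' (.inl (.inr k))) (hA' (.inr k))
  have hle : ∀ i, M i ≤ mΩ := by
    rintro ((_ | k) | k)
    · exact hG
    · exact (hp k).trans (hm k)
    · exact (hf k).trans (hm k)
  have := indep_iSup_of_disjoint hle hM
    (S := Set.range Sum.inl) (T := Set.range Sum.inr) (by
      rw [Set.disjoint_left]
      rintro _ ⟨a, rfl⟩ ⟨b, hb⟩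
      cases hb)
  rw [iSup_range, iSup_range, iSup_sum] at this
  simpa [M] using this

/-- Finitely many past times determine the past. Sorted, they form a chain along which the values of
S are sums of consecutive increments, and these are independent of the next increment. -/
theorem indep_past_increment [IsProbabilityMeasure P] {S : ℝ≥0 → Ω → ℕ}
    (hS : IsStdPoissonProcess P S) (a h : ℝ≥0) :
    Indep (⨆ (s : ℝ≥0) (_ : s ≤ a), MeasurableSpace.comap (S s) ⊤)
      (MeasurableSpace.comap (fun ω => S (a + h) ω - S a ω) ⊤) P := by
  have key : IndepFun (fun ω (s : Set.Iic a) => S s ω) (fun ω => S (a + h) ω - S a ω) P := by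
    refine IndepFun.process_indepFun (fun s => hS.measurable _)
      ((hS.measurable _).sub (hS.measurable _)) fun I => ?_
    -- Adding 0 makes the partial sums start at `S 0 = 0`; adding `a` makes the last past time equal
    -- to `a`, so that the increment with index N - 1 is exactly the future one.
    let F : Finset ℝ≥0 := insert 0 (insert a (I.image Subtype.val))
    have hF : ∀ s ∈ F, s ≤ a := by
      intro s hs
      simp only [F, Finset.mem_insert, Finset.mem_image] at hs
      rcases hs with rfl | rfl | ⟨x, _, rfl⟩
      · exact zero_le
      · exact le_rfl
      · exact x.2
    let N := F.card
    have hN : 0 < N := Finset.card_pos.2 ⟨0, by simp [F]⟩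
    let e : Fin N ↪o ℝ≥0 := F.orderEmbOfFin rfl
    let t : ℕ → ℝ≥0 := fun l => if hl : l < N then e ⟨l, hl⟩ else a + h
    have htF : ∀ l, l < N → t l ∈ F := fun l hl => by
      simp only [t, hl, dif_pos]
      exact Finset.orderEmbOfFin_mem _ _ _
    have hmem : ∀ s ∈ F, ∃ l, l < N ∧ t l = s := by
      intro s hs
      have : s ∈ Set.range e := by
        rw [Finset.range_orderEmbOfFin]; exact hs
      obtain ⟨l, rfl⟩ := this
      exact ⟨l, l.2, by simp [t, l.2]⟩
    have htm : Monotone t := by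
      intro l l' hll
      by_cases h1 : l' < N
      · simp only [t, h1, hll.trans_lt h1, dif_pos]
        exact e.monotone hll
      · by_cases h2 : l < N
        · have : t l ≤ a := hF _ (htF l h2)
          have h3 : t l' = a + h := by simp [t, h1]
          rw [h3]; exact this.trans le_self_add
        · simp [t, h1, h2]
    have ht0 : t 0 = 0 := by
      obtain ⟨l, hl, h0⟩ := hmem 0 (by simp [F])
      exact le_antisymm (h0 ▸ htm (Nat.zero_le l)) zero_le
    have htl : t (N - 1) = a := by
      obtain ⟨l, hl, h0⟩ := hmem a (by simp [F])
      refine le_antisymm (hF _ (htF _ (by omega))) (h0 ▸ htm (by omega))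
    have htN : t N = a + h := by simp [t]
    have hind := (hS.indep.nat htm).indepFun_finset (Finset.range (N - 1)) {N - 1}
      (by simp) (fun l => (hS.measurable _).sub (hS.measurable _))
    have hix : ∀ x : I, ∃ l, l < N ∧ t l = x.1.1 := fun x =>
      hmem _ (by simp only [F, Finset.mem_insert, Finset.mem_image]; exact .inr (.inr ⟨x.1, x.2, rfl⟩))
    choose ix hixN hixt using hix
    let φ : (Finset.range (N - 1) → ℕ) → (I → ℕ) := fun v x =>
      ∑ l : Finset.range (N - 1), if l.1 < ix x then v l else 0
    let ψ : (({N - 1} : Finset ℕ) → ℕ) → ℕ := fun v => v ⟨N - 1, by simp⟩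
    have hψ : Measurable ψ := measurable_pi_apply _
    have := hind.comp (φ := φ) (ψ := ψ) (by
      refine measurable_pi_iff.2 fun x => Finset.measurable_sum _ fun l _ => ?_
      by_cases h : l.1 < ix x
      · simp only [h, if_true]; exact measurable_pi_apply l
      · simp only [h, if_false]; exact measurable_const) hψ
    convert! this using 1
    · ext ω x
      simp only [Function.comp, φ]
      rw [Finset.sum_coe_sort (Finset.range (N - 1))
        (fun l => if l < ix x then S (t (l + 1)) ω - S (t l) ω else 0), ← Finset.sum_filter]
      have : (Finset.range (N - 1)).filter (fun l => l < ix x) = Finset.range (ix x) := by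
        ext l
        have := hixN x
        simp only [Finset.mem_filter, Finset.mem_range]
        omega
      rw [this, Finset.sum_range_tsub (f := fun l => S (t l) ω) ((hS.mono ω).comp htm), ht0,
        hS.zero, hixt]
      simp
    · ext ω
      simp only [Function.comp, ψ]
      rw [htl, Nat.sub_add_cancel hN, htN]
  refine indep_of_indep_of_le_left ((IndepFun_iff_Indep _ _ _).1 key) ?_
  refine iSup₂_le fun s hs => ?_
  rw [← measurable_iff_comap_le]
  exact (measurable_pi_apply (⟨s, hs⟩ : Set.Iic a)).comp
    (comap_measurable (fun ω (s : Set.Iic a) => S s ω))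

end Independence

/-! ### Exponential moments of Poisson laws -/

theorem integrable_exp_poissonMeasure (h : ℝ≥0) :
    Integrable (fun k : ℕ => Real.exp k) (poissonMeasure h) := by
  rw [integrable_poissonMeasure_iff]
  have := (Real.summable_pow_div_factorial (h * Real.exp 1)).mul_left (Real.exp (-h))
  refine this.congr fun k => ?_
  rw [Real.norm_of_nonneg (Real.exp_pos _).le, mul_pow, ← Real.exp_nat_mul, mul_one]
  ring

theorem integral_exp_poissonMeasure (h : ℝ≥0) :
    ∫ k : ℕ, Real.exp k ∂(poissonMeasure h) = Real.exp (h * (Real.exp 1 - 1)) := by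
  rw [integral_poissonMeasure]
  have h1 : ∀ k : ℕ, (Real.exp (-h) * (h : ℝ) ^ k / k.factorial) • Real.exp k =
      Real.exp (-h) * ((h * Real.exp 1) ^ k / k.factorial) := by
    intro k
    rw [mul_pow, ← Real.exp_nat_mul, mul_one, smul_eq_mul]
    ring
  simp_rw [h1]
  rw [tsum_mul_left, ← congrFun NormedSpace.exp_eq_tsum_div, ← Real.exp_eq_exp_ℝ, ← Real.exp_add]
  congr 1
  ring

/-- Exponential Markov inequality with parameter 1, where the moment generating function of a
Poisson law of mean h is exp(h(e - 1)). -/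
theorem measure_le_sum_poisson {Ω ι : Type*} {mΩ : MeasurableSpace Ω} {P : Measure Ω}
    [IsProbabilityMeasure P] {Y : ι → Ω → ℕ} (hY : ∀ k, Measurable (Y k)) (hind : iIndepFun Y P)
    {h : ℝ≥0} (hlaw : ∀ k, P.map (Y k) = poissonMeasure h) (s : Finset ι) (c : ℝ) :
    P {ω | c ≤ ∑ k ∈ s, (Y k ω : ℝ)} ≤
      ENNReal.ofReal (Real.exp (s.card * (h * (Real.exp 1 - 1)) - c)) := by
  have hR : iIndepFun (fun k ω => (Y k ω : ℝ)) P :=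
    hind.comp (fun _ (n : ℕ) => (n : ℝ)) fun _ => measurable_from_top
  have hRm : ∀ k, Measurable fun ω => (Y k ω : ℝ) := fun k => measurable_from_top.comp (hY k)
  have hint : ∀ k, Integrable (fun ω => Real.exp (1 * (Y k ω : ℝ))) P := by
    intro k
    have := integrable_exp_poissonMeasure h
    rw [← hlaw k, integrable_map_measure (by fun_prop) (hY k).aemeasurable] at this
    simpa [Function.comp_def] using this
  have hmgf : ∀ k, mgf (fun ω => (Y k ω : ℝ)) P 1 = Real.exp (h * (Real.exp 1 - 1)) := by
    intro k
    rw [← integral_exp_poissonMeasure, ← hlaw k, integral_map (hY k).aemeasurable (by fun_prop)]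
    simp [mgf]
  have h1 := measure_ge_le_exp_mul_mgf (μ := P) (X := ∑ k ∈ s, fun ω => (Y k ω : ℝ)) c
    zero_le_one (hR.integrable_exp_mul_sum hRm fun k _ => hint k)
  rw [hR.mgf_sum hRm, Finset.prod_congr rfl fun k _ => hmgf k, Finset.prod_const,
    ← Real.exp_nat_mul, ← Real.exp_add] at h1
  rw [← ENNReal.ofReal_toReal (measure_ne_top P _)]
  refine ENNReal.ofReal_le_ofReal ?_
  simp only [Finset.sum_apply] at h1
  refine h1.trans (le_of_eq ?_)
  congr 1
  ring

/-- A stopping vector rounded up to a grid is still a stopping vector. Only joint events {σ k ≤ a k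
for all k} are known to be measurable, so equality is expressed by removing, for each k, the joint
event with the k-th bound lowered by one. -/
theorem measurableSet_ceil_eq {Ω ι : Type*} [Countable ι] {F : (ι → ℝ≥0) → MeasurableSpace Ω}
    (hF : Monotone F) {σ : ι → Ω → ℝ≥0} (hσ : ∀ a, MeasurableSet[F a] {ω | ∀ k, σ k ω ≤ a k})
    {d : ℝ≥0} (hd : 0 < d) (e : ι → ℕ) :
    MeasurableSet[F fun k => e k / d] {ω | ∀ k, ⌈σ k ω * d⌉₊ = e k} := by
  classical
  have hν : ∀ k ω (m : ℕ), ⌈σ k ω * d⌉₊ ≤ m ↔ σ k ω ≤ m / d := fun k ω m => by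
    rw [Nat.ceil_le, le_div_iff₀ hd]
  have hle : ∀ e' : ι → ℕ, e' ≤ e →
      MeasurableSet[F fun k => e k / d] {ω | ∀ k, ⌈σ k ω * d⌉₊ ≤ e' k} := by
    intro e' hee
    simp only [hν]
    exact hF (fun k => div_le_div_of_nonneg_right (by exact_mod_cast hee k) zero_le) _ (hσ _)
  -- The guard `0 < e k` is needed because `e k - 1` is truncated at zero.
  have : {ω | ∀ k, ⌈σ k ω * d⌉₊ = e k} = {ω | ∀ k, ⌈σ k ω * d⌉₊ ≤ e k} \
      ⋃ k, {ω | 0 < e k ∧ ∀ k', ⌈σ k' ω * d⌉₊ ≤ Function.update e k (e k - 1) k'} := by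
    ext ω
    simp only [Set.mem_ofPred_eq, Set.mem_sdiff, Set.mem_iUnion, not_exists, not_and]
    constructor
    · intro hω
      refine ⟨fun k => (hω k).le, fun k hk hall => ?_⟩
      have := hall k
      rw [hω k, Function.update_self] at this
      omega
    · rintro ⟨h1, h2⟩ k
      by_contra hne
      have hlt : ⌈σ k ω * d⌉₊ < e k := lt_of_le_of_ne (h1 k) hne
      refine h2 k (by omega) fun k' => ?_
      by_cases hk : k' = k
      · subst hk
        rw [Function.update_self]
        omega
      · rw [Function.update_of_ne hk]
        exact h1 k'
  rw [this]
  refine (hle e le_rfl).diff (MeasurableSet.iUnion fun k => ?_)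
  by_cases hk : 0 < e k
  · simp only [hk, true_and]
    refine hle _ fun k' => ?_
    by_cases hkk : k' = k
    · subst hkk
      rw [Function.update_self]
      exact Nat.sub_le _ _
    · rw [Function.update_of_ne hkk]
  · simp only [hk, false_and]
    exact @MeasurableSet.const Ω (F _) False

/-- Approximation from the right, as required by paths that are only right-continuous. -/
theorem tendsto_ceil_mul_div (x : ℝ≥0) :
    Tendsto (fun l : ℕ => (⌈x * (l + 1)⌉₊ : ℝ≥0) / (l + 1)) atTop (𝓝[≥] x) := by
  have hd : ∀ l : ℕ, (0 : ℝ≥0) < l + 1 := fun l => by positivity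
  have hge : ∀ l : ℕ, x ≤ (⌈x * (l + 1)⌉₊ : ℝ≥0) / (l + 1) := fun l => by
    rw [le_div_iff₀ (hd l)]
    exact Nat.le_ceil _
  refine tendsto_nhdsWithin_iff.2 ⟨?_, Eventually.of_forall hge⟩
  have hinv : Tendsto (fun l : ℕ => x + 1 / ((l : ℝ≥0) + 1)) atTop (𝓝 (x + 0)) :=
    tendsto_const_nhds.add tendsto_one_div_add_atTop_nhds_zero_nat
  rw [add_zero] at hinv
  refine tendsto_of_tendsto_of_tendsto_of_le_of_le tendsto_const_nhds hinv hge fun l => ?_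
  show (⌈x * (l + 1)⌉₊ : ℝ≥0) / (l + 1) ≤ x + 1 / ((l : ℝ≥0) + 1)
  rw [div_le_iff₀ (hd l), add_mul, one_div, inv_mul_cancel₀ (hd l).ne']
  exact (Nat.ceil_lt_add_one zero_le).le

/-! ### Increments after a multi-parameter stopping time -/

/-- The information in `G` and in the restrictions of the processes `W k` to `[0, a k]`. -/
abbrev pastInfo {Ω ι : Type*} (G : MeasurableSpace Ω) (W : ι → ℝ≥0 → Ω → ℕ) (a : ι → ℝ≥0) :
    MeasurableSpace Ω :=
  G ⊔ ⨆ (k : ι) (s : ℝ≥0) (_ : s ≤ a k), MeasurableSpace.comap (W k s) ⊤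

theorem pastInfo_mono {Ω ι : Type*} {G : MeasurableSpace Ω} {W : ι → ℝ≥0 → Ω → ℕ} :
    Monotone (pastInfo G W) := by
  intro a a' haa
  refine sup_le_sup_left ?_ G
  refine iSup_mono fun k => iSup₂_le fun s hs => ?_
  have hs' : s ≤ a' k := hs.trans (haa k)
  exact le_iSup₂_of_le (f := fun s (_ : s ≤ a' k) => MeasurableSpace.comap (W k s) ⊤)
    s hs' le_rfl

section StrongMarkov

variable {Ω ι : Type*} {G : MeasurableSpace Ω} {mΩ : MeasurableSpace Ω} {P : Measure Ω}
  [IsProbabilityMeasure P] [Fintype ι] {W : ι → ℝ≥0 → Ω → ℕ}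

theorem indep_stopped_increments (hW : ∀ k, IsStdPoissonProcess P (W k))
    (hind : iIndepFun (fun k ω t => W k t ω) P) (hG : G ≤ mΩ)
    (hGW : Indep G (⨆ (k : ι) (s : ℝ≥0), MeasurableSpace.comap (W k s) ⊤) P) (a : ι → ℝ≥0)
    (h : ℝ≥0) :
    Indep (pastInfo G W a)
      (⨆ k, MeasurableSpace.comap (fun ω => W k (a k + h) ω - W k (a k) ω) ⊤) P := by
  have hle : ∀ k s, MeasurableSpace.comap (W k s) ⊤ ≤
      ⨆ s : ℝ≥0, MeasurableSpace.comap (W k s) ⊤ := fun k s =>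
    le_iSup (fun s => MeasurableSpace.comap (W k s) ⊤) s
  refine indep_sup_iSup_of_iIndep (m := fun k => ⨆ s : ℝ≥0, MeasurableSpace.comap (W k s) ⊤) hG
    (fun k => iSup_le fun s => ((hW k).measurable s).comap_le)
    (fun k => iSup₂_le fun s _ => hle k s) (fun k => ?_) ?_ hGW
    fun k => indep_past_increment (hW k) (a k) h
  · rw [← measurable_iff_comap_le]
    have h1 : ∀ s, Measurable[⨆ s : ℝ≥0, MeasurableSpace.comap (W k s) ⊤] (W k s) := fun s =>
      measurable_iff_comap_le.2 (hle k s)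
    exact (h1 _).sub (h1 _)
  · have := (iIndepFun_iff_iIndep _ _ _).1 hind
    simp only [MeasurableSpace.pi, MeasurableSpace.comap_iSup, MeasurableSpace.comap_comp,
      Function.comp_def] at this
    exact this

/-- On each piece `A e` the stopping vector is the constant `a e`, and the later increments are
independent of `A e`. The bound is the same for all pieces, whose probabilities add up to at most 1.
-/
theorem measure_stopped_increments_countable (hW : ∀ k, IsStdPoissonProcess P (W k))
    (hind : iIndepFun (fun k ω t => W k t ω) P) (hG : G ≤ mΩ)
    (hGW : Indep G (⨆ (k : ι) (s : ℝ≥0), MeasurableSpace.comap (W k s) ⊤) P)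
    {E : Type*} [Countable E] (a : E → ι → ℝ≥0) (A : E → Set Ω)
    (hA : ∀ e, MeasurableSet[pastInfo G W (a e)] (A e))
    (hAd : Pairwise (Function.onFun Disjoint A)) (s : Finset ι) (h : ℝ≥0) (c : ℝ) :
    P (⋃ e, A e ∩ {ω | c ≤ ∑ k ∈ s, ((W k (a e k + h) ω - W k (a e k) ω : ℕ) : ℝ)}) ≤
      ENNReal.ofReal (Real.exp (s.card * (h * (Real.exp 1 - 1)) - c)) := by
  set b := ENNReal.ofReal (Real.exp (s.card * (h * (Real.exp 1 - 1)) - c))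
  have hpast : ∀ e, pastInfo G W (a e) ≤ mΩ := fun e =>
    sup_le hG (iSup_le fun k => iSup₂_le fun s _ => ((hW k).measurable s).comap_le)
  have h1 : ∀ e, P (A e ∩ {ω | c ≤ ∑ k ∈ s,
      ((W k (a e k + h) ω - W k (a e k) ω : ℕ) : ℝ)}) ≤ P (A e) * b := by
    intro e
    have hm : ∀ k, Measurable[⨆ k, MeasurableSpace.comap
        (fun ω => W k (a e k + h) ω - W k (a e k) ω) ⊤]
        (fun ω => ((W k (a e k + h) ω - W k (a e k) ω : ℕ) : ℝ)) := fun k =>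
      (measurable_from_top (f := fun n : ℕ => (n : ℝ))).comp (measurable_iff_comap_le.2
        (le_iSup (fun k => MeasurableSpace.comap
          (fun ω => W k (a e k + h) ω - W k (a e k) ω) ⊤) k))
    rw [(Indep_iff _ _ _).1 (indep_stopped_increments hW hind hG hGW (a e) h) _ _ (hA e)
      (measurableSet_le measurable_const (Finset.measurable_sum _ fun k _ => hm k))]
    gcongr
    refine measure_le_sum_poisson (fun k => ((hW k).measurable _).sub ((hW k).measurable _)) ?_
      (fun k => (hW k).law _ _) s c
    exact hind.comp (fun k (w : ℝ≥0 → ℕ) => w (a e k + h) - w (a e k))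
      fun k => (measurable_pi_apply _).sub (measurable_pi_apply _)
  calc _ ≤ ∑' e, P (A e ∩ {ω | c ≤ ∑ k ∈ s,
      ((W k (a e k + h) ω - W k (a e k) ω : ℕ) : ℝ)}) := measure_iUnion_le _
    _ ≤ ∑' e, P (A e) * b := ENNReal.tsum_le_tsum h1
    _ = (∑' e, P (A e)) * b := ENNReal.tsum_mul_right
    _ ≤ 1 * b := by
      gcongr
      rw [← measure_iUnion hAd fun e => hpast e _ (hA e)]
      exact prob_le_one
    _ = b := one_mul _

/-- Strong Markov property in the form of a tail bound: the processes may be stopped at different,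
mutually dependent levels. Rounding the levels up to multiples of 1/(l+1) reduces to countably many
values, and right-continuity lets l tend to infinity. -/
theorem measure_stopped_increments_le (hW : ∀ k, IsStdPoissonProcess P (W k))
    (hind : iIndepFun (fun k ω t => W k t ω) P) (hG : G ≤ mΩ)
    (hGW : Indep G (⨆ (k : ι) (s : ℝ≥0), MeasurableSpace.comap (W k s) ⊤) P)
    {σ : ι → Ω → ℝ≥0}
    (hσ : ∀ a : ι → ℝ≥0, MeasurableSet[pastInfo G W a] {ω | ∀ k, σ k ω ≤ a k})
    (s : Finset ι) (h : ℝ≥0) (c : ℝ) :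
    P {ω | c ≤ ∑ k ∈ s, ((W k (σ k ω + h) ω - W k (σ k ω) ω : ℕ) : ℝ)} ≤
      ENNReal.ofReal (Real.exp (s.card * (h * (Real.exp 1 - 1)) - c)) := by
  set b := ENNReal.ofReal (Real.exp (s.card * (h * (Real.exp 1 - 1)) - c))
  let ν : ℕ → ι → Ω → ℝ≥0 := fun l k ω => (⌈σ k ω * (l + 1)⌉₊ : ℝ≥0) / (l + 1)
  let R : ℕ → Set Ω := fun l => {ω | c ≤ ∑ k ∈ s,
    ((W k (ν l k ω + h) ω - W k (ν l k ω) ω : ℕ) : ℝ)}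
  have hR : ∀ l, P (R l) ≤ b := by
    intro l
    refine (measure_mono fun ω hω => ?_).trans
      (measure_stopped_increments_countable hW hind hG hGW
        (fun (e : ι → ℕ) k => (e k : ℝ≥0) / (l + 1))
        (fun e => {ω | ∀ k, ⌈σ k ω * (l + 1)⌉₊ = e k})
        (measurableSet_ceil_eq pastInfo_mono hσ (by positivity)) ?_ s h c)
    · simp only [Set.mem_iUnion]
      exact ⟨fun k => ⌈σ k ω * (l + 1)⌉₊, fun k => rfl, by
        simpa only [R, ν, Set.mem_ofPred_eq] using hω⟩
    · intro e e' hee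
      rw [Function.onFun, Set.disjoint_left]
      intro ω h1 h2
      exact hee (funext fun k => (h1 k).symm.trans (h2 k))
  -- The paths are integer-valued, so convergence means being eventually equal; the event therefore
  -- lies in the limit inferior of the sets `R l`.
  have hev : ∀ k ω (x : ℝ≥0), ∀ᶠ l in atTop,
      W k (ν l k ω + x) ω = W k (σ k ω + x) ω := by
    intro k ω x
    have hadd : Tendsto (fun l => ν l k ω + x) atTop (𝓝[≥] (σ k ω + x)) := by
      have h0 := tendsto_nhdsWithin_iff.1 (tendsto_ceil_mul_div (σ k ω))
      exact tendsto_nhdsWithin_iff.2 ⟨h0.1.add_const x, h0.2.mono fun l hl =>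
        add_le_add_left hl x⟩
    have := (((hW k).cadlag ω).right_cont (σ k ω + x)).tendsto.comp hadd
    rw [nhds_discrete, tendsto_pure] at this
    exact this
  have hsub : {ω | c ≤ ∑ k ∈ s, ((W k (σ k ω + h) ω - W k (σ k ω) ω : ℕ) : ℝ)} ⊆
      ⋃ l₀, ⋂ l ≥ l₀, R l := by
    intro ω hω
    have : ∀ᶠ l in atTop, ∀ k, W k (ν l k ω + h) ω = W k (σ k ω + h) ω ∧
        W k (ν l k ω) ω = W k (σ k ω) ω := by
      refine eventually_all.2 fun k => (hev k ω h).and ?_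
      simpa using hev k ω 0
    obtain ⟨l₀, hl₀⟩ := eventually_atTop.1 this
    simp only [Set.mem_iUnion, Set.mem_iInter]
    refine ⟨l₀, fun l hl => ?_⟩
    simp only [R, Set.mem_ofPred_eq]
    rw [Finset.sum_congr rfl fun k _ => by rw [(hl₀ l hl k).1, (hl₀ l hl k).2]]
    exact hω
  refine (measure_mono hsub).trans ?_
  have hmon : Monotone fun l₀ => ⋂ l ≥ l₀, R l := by
    intro l l' hll
    refine Set.iInter₂_mono' fun m hm => ⟨m, hll.trans hm, subset_rfl⟩
  rw [hmon.measure_iUnion]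
  exact iSup_le fun l₀ => (measure_mono (Set.iInter₂_subset l₀ le_rfl)).trans (hR l₀)

end StrongMarkov

/-! ### Deviations of renewal processes -/

/-- No lower bound on x is required, which is what permits the use for -u with u unbounded. -/
theorem exp_le_one_add_add_sq {x : ℝ} (hx : x ≤ 1) : Real.exp x ≤ 1 + x + x ^ 2 := by
  by_cases h : -1 ≤ x
  · have := (abs_le.1 (Real.abs_exp_sub_one_sub_id_le (abs_le.2 ⟨h, hx⟩))).2
    linarith
  · have : Real.exp x ≤ 1 := Real.exp_le_one_iff.2 (by linarith)
    nlinarith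

section Chernoff

variable {Ω : Type*} [MeasurableSpace Ω] {P : Measure Ω} [IsProbabilityMeasure P]

theorem integrable_exp_mul_of_mul_le_one {Y : Ω → ℝ} (hY : Measurable Y) {θ : ℝ}
    (h : ∀ᵐ ω ∂P, θ * Y ω ≤ 1) : Integrable (fun ω => Real.exp (θ * Y ω)) P := by
  refine Integrable.of_bound (by fun_prop) (Real.exp 1) ?_
  filter_upwards [h] with ω hω
  rw [Real.norm_of_nonneg (Real.exp_pos _).le]
  exact Real.exp_le_exp.2 hω

theorem mgf_le_of_mul_le_one {Y : Ω → ℝ} (hY : Measurable Y) (hY1 : Integrable Y P)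
    (hY2 : Integrable (fun ω => Y ω ^ 2) P) {θ m σ : ℝ} (hθ : 0 ≤ θ)
    (h : ∀ᵐ ω ∂P, θ * Y ω ≤ 1) (hm : ∫ ω, Y ω ∂P ≤ m) (hσ : ∫ ω, Y ω ^ 2 ∂P ≤ σ) :
    mgf Y P θ ≤ Real.exp (θ * m + θ ^ 2 * σ) := by
  have h1 : mgf Y P θ ≤ ∫ ω, (1 + θ * Y ω + θ ^ 2 * Y ω ^ 2) ∂P := by
    refine integral_mono_ae (integrable_exp_mul_of_mul_le_one hY h)
      (((integrable_const 1).add (hY1.const_mul θ)).add (hY2.const_mul (θ ^ 2))) ?_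
    filter_upwards [h] with ω hω
    have := exp_le_one_add_add_sq hω
    rwa [mul_pow] at this
  have hi : Integrable (fun ω => 1 + θ * Y ω) P := (integrable_const 1).add (hY1.const_mul θ)
  rw [integral_add hi (hY2.const_mul (θ ^ 2)),
    integral_add (integrable_const 1) (hY1.const_mul θ), integral_const_mul,
    integral_const_mul] at h1
  simp only [integral_const, probReal_univ, one_smul] at h1
  have h2 := Real.add_one_le_exp (θ * m + θ ^ 2 * σ)
  have h3 := mul_le_mul_of_nonneg_left hm hθ
  have h4 := mul_le_mul_of_nonneg_left hσ (sq_nonneg θ)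
  linarith

/-- The assumption θσ ≤ η lets the slope η absorb the quadratic term of the exponent, so that only
exp(-θx) remains, whatever the number of summands. -/
theorem measure_sum_ge_le {ι : Type*} {Y : ι → Ω → ℝ} (hY : ∀ i, Measurable (Y i))
    (hind : iIndepFun Y P) {s : Finset ι} {θ m σ η : ℝ} (hθ : 0 ≤ θ) (hση : θ * σ ≤ η)
    (hint : ∀ i ∈ s, Integrable (fun ω => Real.exp (θ * Y i ω)) P)
    (hmgf : ∀ i ∈ s, mgf (Y i) P θ ≤ Real.exp (θ * m + θ ^ 2 * σ)) (x : ℝ) :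
    P {ω | s.card * (m + η) + x ≤ ∑ i ∈ s, Y i ω} ≤ ENNReal.ofReal (Real.exp (-(θ * x))) := by
  have h1 := measure_ge_le_exp_mul_mgf (μ := P) (X := ∑ i ∈ s, Y i) (s.card * (m + η) + x)
    hθ (hind.integrable_exp_mul_sum hY hint)
  rw [hind.mgf_sum hY] at h1
  have h2 : ∏ i ∈ s, mgf (Y i) P θ ≤ Real.exp (s.card * (θ * m + θ ^ 2 * σ)) := by
    rw [Real.exp_nat_mul, ← Finset.prod_const]
    exact Finset.prod_le_prod (fun i _ => mgf_nonneg) hmgf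
  rw [← ENNReal.ofReal_toReal (measure_ne_top P _)]
  refine ENNReal.ofReal_le_ofReal ?_
  simp only [Finset.sum_apply] at h1
  refine h1.trans ((mul_le_mul_of_nonneg_left h2 (Real.exp_pos _).le).trans ?_)
  rw [← Real.exp_add, Real.exp_le_exp]
  have h3 : (s.card : ℝ) * θ * (θ * σ) ≤ s.card * θ * η :=
    mul_le_mul_of_nonneg_left hση (by positivity)
  nlinarith

end Chernoff

namespace IsDelayedRenewalSequence

variable {Ω : Type*} [MeasurableSpace Ω] {P : Measure Ω} {u : ℕ → Ω → ℝ}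

theorem memLp_two [IsProbabilityMeasure P] (hu : IsDelayedRenewalSequence P u) {l : ℕ} (hl : 1 ≤ l) :
    MemLp (u l) 2 P := by
  obtain ⟨δ, hδ, h⟩ := hu.moment
  refine ((hu.ident l hl).memLp_iff).2 (h.mono_exponent ?_)
  rw [← ENNReal.ofReal_ofNat]
  exact ENNReal.ofReal_le_ofReal (by linarith)

theorem integral_eq_one (hu : IsDelayedRenewalSequence P u) {l : ℕ} (hl : 1 ≤ l) :
    ∫ ω, u l ω ∂P = 1 :=
  (hu.ident l hl).integral_eq.trans hu.mean

theorem integral_sq_eq (hu : IsDelayedRenewalSequence P u) {l : ℕ} (hl : 1 ≤ l) :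
    ∫ ω, u l ω ^ 2 ∂P = ∫ ω, u 1 ω ^ 2 ∂P :=
  (hu.ident l hl).sq.integral_eq

variable [IsProbabilityMeasure P]

/-- The parameter θ = 1/K keeps θ · min(u, K) below 1. Blocks start at index at least 1 because
nothing is known about the law of the delay `u 0`. -/
theorem measure_truncated_sum_ge_le (hu : IsDelayedRenewalSequence P u) {K η : ℝ} (hK : 0 < K)
    (hη : K⁻¹ * ∫ ω, u 1 ω ^ 2 ∂P ≤ η) (x : ℝ) {a : ℕ} (ha : 1 ≤ a) (b : ℕ) :
    P {ω | (b - a : ℕ) * (1 + η) + x ≤ ∑ l ∈ Finset.Ico a b, min (u l ω) K} ≤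
      ENNReal.ofReal (Real.exp (-(K⁻¹ * x))) := by
  have hm : ∀ l, Measurable fun ω => min (u l ω) K := fun l =>
    (hu.measurable l).min measurable_const
  have h1 : ∀ l, ∀ᵐ ω ∂P, K⁻¹ * min (u l ω) K ≤ 1 := fun l => .of_forall fun ω => by
    rw [inv_mul_le_iff₀ hK, mul_one]
    exact min_le_right _ _
  have h2 : ∀ l, 1 ≤ l → MemLp (fun ω => min (u l ω) K) 2 P := fun l hl =>
    (hu.memLp_two hl).mono (hm l).aestronglyMeasurable (by
      filter_upwards [hu.nonneg l] with ω hω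
      rw [Real.norm_of_nonneg hω, Real.norm_of_nonneg (le_min hω hK.le)]
      exact min_le_left _ _)
  have := measure_sum_ge_le hm (s := Finset.Ico a b) (m := 1)
    (hu.indep.comp (fun _ y => min y K) fun _ => measurable_id.min measurable_const)
    (inv_nonneg.2 hK.le) hη (fun l _ => integrable_exp_mul_of_mul_le_one (hm l) (h1 l))
    (fun l hl => ?_) x
  · simpa only [Nat.card_Ico] using this
  · have hl1 : 1 ≤ l := ha.trans (Finset.mem_Ico.1 hl).1
    refine mgf_le_of_mul_le_one (hm l) ((h2 l hl1).integrable (by norm_num))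
      (h2 l hl1).integrable_sq (inv_nonneg.2 hK.le) (h1 l) ?_ ?_
    · rw [← hu.integral_eq_one hl1]
      exact integral_mono ((h2 l hl1).integrable (by norm_num))
        ((hu.memLp_two hl1).integrable (by norm_num)) fun ω => min_le_left _ _
    · rw [← hu.integral_sq_eq hl1]
      refine integral_mono_ae (h2 l hl1).integrable_sq (hu.memLp_two hl1).integrable_sq ?_
      filter_upwards [hu.nonneg l] with ω hω
      exact pow_le_pow_left₀ (le_min hω hK.le) (min_le_left _ _) 2

/-- Nonnegativity of u bounds -u above, so no truncation is needed on this side. -/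
theorem measure_sum_le_le (hu : IsDelayedRenewalSequence P u) {K η : ℝ} (hK : 0 < K)
    (hη : K⁻¹ * ∫ ω, u 1 ω ^ 2 ∂P ≤ η) (x : ℝ) {a : ℕ} (ha : 1 ≤ a) (b : ℕ) :
    P {ω | ∑ l ∈ Finset.Ico a b, u l ω ≤ (b - a : ℕ) * (1 - η) - x} ≤
      ENNReal.ofReal (Real.exp (-(K⁻¹ * x))) := by
  have h1 : ∀ l, ∀ᵐ ω ∂P, K⁻¹ * -u l ω ≤ 1 := fun l => by
    filter_upwards [hu.nonneg l] with ω hω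
    have := mul_nonneg (inv_nonneg.2 hK.le) hω
    linarith
  have := measure_sum_ge_le (fun l => (hu.measurable l).neg) (s := Finset.Ico a b) (m := -1)
    (hu.indep.comp (fun _ y => -y) fun _ => measurable_neg)
    (inv_nonneg.2 hK.le) hη (fun l _ => integrable_exp_mul_of_mul_le_one
      (hu.measurable l).neg (h1 l)) (fun l hl => ?_) x
  · refine (measure_mono fun ω hω => ?_).trans this
    simp only [Set.mem_ofPred_eq, Nat.card_Ico, Pi.neg_apply, Finset.sum_neg_distrib] at hω ⊢
    linarith
  · have hl1 : 1 ≤ l := ha.trans (Finset.mem_Ico.1 hl).1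
    refine mgf_le_of_mul_le_one (hu.measurable l).neg
      ((hu.memLp_two hl1).integrable (by norm_num)).neg ?_ (inv_nonneg.2 hK.le) (h1 l) ?_ ?_
    · simpa using (hu.memLp_two hl1).integrable_sq
    · simp [integral_neg, hu.integral_eq_one hl1]
    · simp [hu.integral_sq_eq hl1]

theorem measure_gt_le (hu : IsDelayedRenewalSequence P u) {p : ℝ} (hp : 0 < p)
    (h : MemLp (u 1) (ENNReal.ofReal p) P) {K : ℝ} (hK : 0 < K) {l : ℕ} (hl : 1 ≤ l) :
    P {ω | K < u l ω} ≤ ENNReal.ofReal ((∫ ω, ‖u 1 ω‖ ^ p ∂P) / K ^ p) := by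
  have h0 : P {ω | K < u l ω} = P {ω | K < u 1 ω} :=
    (hu.ident l hl).measure_mem_eq (s := Set.Ioi K) measurableSet_Ioi
  have hi := h.integrable_norm_rpow (by simpa using hp) ENNReal.ofReal_ne_top
  rw [ENNReal.toReal_ofReal hp.le] at hi
  have h1 := mul_meas_ge_le_integral_of_nonneg
    (.of_forall fun ω => by positivity) hi (K ^ p)
  rw [h0, ← ENNReal.ofReal_toReal (measure_ne_top P _)]
  refine ENNReal.ofReal_le_ofReal ?_
  rw [le_div_iff₀' (Real.rpow_pos_of_pos hK p)]
  refine le_trans ?_ h1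
  gcongr
  refine measureReal_mono fun ω hω => ?_
  exact Real.rpow_le_rpow hK.le ((le_of_lt hω).trans (Real.le_norm_self _)) hp.le

/-- Three sources of failure: a long delay, an interarrival time above K, and a block that deviates
after truncation. If no interarrival time exceeds K, truncation changes nothing. -/
theorem measure_sum_deviation_le (hu : IsDelayedRenewalSequence P u) {p : ℝ} (hp : 0 < p)
    (h : MemLp (u 1) (ENNReal.ofReal p) P) {K η x : ℝ} (hK : 0 < K)
    (hη : K⁻¹ * ∫ ω, u 1 ω ^ 2 ∂P ≤ η) (hx : 1 ≤ x) (M : ℕ) :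
    P {ω | ∃ a b : ℕ, a ≤ b ∧ b ≤ M ∧
        η * (b - a : ℕ) + 3 * x < |∑ l ∈ Finset.Ico a b, u l ω - (b - a : ℕ)|} ≤
      P {ω | x < u 0 ω} + M * ENNReal.ofReal ((∫ ω, ‖u 1 ω‖ ^ p ∂P) / K ^ p) +
        (M + 1) * ((M + 1) * (2 * ENNReal.ofReal (Real.exp (-(K⁻¹ * x))))) := by
  have hη0 : 0 ≤ η := le_trans (mul_nonneg (inv_nonneg.2 hK.le)
    (integral_nonneg fun ω => sq_nonneg _)) hη
  set E₀ := {ω | ∃ l, u l ω < 0}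
  set E₁ := {ω | x < u 0 ω}
  set E₂ := ⋃ l ∈ Finset.Icc 1 M, {ω | K < u l ω}
  let F : ℕ → ℕ → Set Ω := fun a b =>
    {ω | (b - (a + 1) : ℕ) * (1 + η) + x ≤ ∑ l ∈ Finset.Ico (a + 1) b, min (u l ω) K} ∪
      {ω | ∑ l ∈ Finset.Ico (a + 1) b, u l ω ≤ (b - (a + 1) : ℕ) * (1 - η) - x}
  set E₃ := ⋃ a ∈ Finset.range (M + 1), ⋃ b ∈ Finset.range (M + 1), F a b
  have hE₀ : P E₀ = 0 := by
    have := ae_all_iff.2 hu.nonneg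
    rw [ae_iff] at this
    simpa [E₀] using this
  have hE₂ : P E₂ ≤ M * ENNReal.ofReal ((∫ ω, ‖u 1 ω‖ ^ p ∂P) / K ^ p) := by
    refine (measure_biUnion_finset_le _ _).trans ((Finset.sum_le_sum fun l hl =>
      hu.measure_gt_le hp h hK (Finset.mem_Icc.1 hl).1).trans ?_)
    simp
  have hE₃ : P E₃ ≤ (M + 1) * ((M + 1) * (2 * ENNReal.ofReal (Real.exp (-(K⁻¹ * x))))) := by
    have hF : ∀ a b, P (F a b) ≤ 2 * ENNReal.ofReal (Real.exp (-(K⁻¹ * x))) := fun a b => by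
      rw [two_mul]
      exact (measure_union_le _ _).trans (add_le_add
        (hu.measure_truncated_sum_ge_le hK hη x (Nat.le_add_left 1 a) b)
        (hu.measure_sum_le_le hK hη x (Nat.le_add_left 1 a) b))
    refine (measure_biUnion_finset_le _ _).trans ((Finset.sum_le_sum fun a _ =>
      (measure_biUnion_finset_le _ _).trans (Finset.sum_le_sum fun b _ => hF a b)).trans ?_)
    simp
  have hsub : {ω | ∃ a b : ℕ, a ≤ b ∧ b ≤ M ∧
      η * (b - a : ℕ) + 3 * x < |∑ l ∈ Finset.Ico a b, u l ω - (b - a : ℕ)|} ⊆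
      E₀ ∪ (E₁ ∪ E₂ ∪ E₃) := by
    rintro ω ⟨a, b, hab, hbM, hω⟩
    by_contra hnot
    simp only [Set.mem_union, not_or] at hnot
    obtain ⟨h0, ⟨h1, h2⟩, h3⟩ := hnot
    simp only [E₀, E₁, Set.mem_ofPred_eq, not_exists, not_lt] at h0 h1
    simp only [E₂, Set.mem_iUnion, Finset.mem_Icc, Set.mem_ofPred_eq, not_exists, not_lt] at h2
    simp only [E₃, F, Set.mem_iUnion, Finset.mem_range, not_exists, Set.mem_union,
      Set.mem_ofPred_eq, not_or, not_le] at h3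
    have key : ∀ a, a + 1 ≤ b → |∑ l ∈ Finset.Ico (a + 1) b, u l ω - (b - (a + 1) : ℕ)| ≤
        η * (b - (a + 1) : ℕ) + x := by
      intro a ha
      obtain ⟨h4, h5⟩ := h3 a (by omega) b (by omega)
      rw [Finset.sum_congr rfl fun l hl => min_eq_left (h2 l (by
        have := Finset.mem_Ico.1 hl
        omega))] at h4
      rw [abs_le]
      constructor <;> linarith
    refine absurd hω (not_lt.2 ?_)
    -- A block starting at 0 is split into the delay and a block starting at 1. The delay shifts the
    -- deviation by a number between -1 and x, which the budget 3x covers because 1 ≤ x.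
    rcases Nat.eq_zero_or_pos a with rfl | ha
    · rcases Nat.eq_zero_or_pos b with rfl | hb
      · simp
        positivity
      · rw [Finset.sum_eq_sum_Ico_succ_bot hb]
        have h6 := key 0 hb
        have h7 : ((b - 0 : ℕ) : ℝ) = (b - (0 + 1) : ℕ) + 1 := by
          rw [← Nat.cast_add_one]
          congr 1
          omega
        rw [h7]
        rw [abs_le] at h6 ⊢
        have := h0 0
        constructor <;> linarith
    · obtain ⟨a, rfl⟩ := Nat.exists_eq_succ_of_ne_zero ha.ne'
      exact (key a hab).trans (by linarith)
  refine (measure_mono hsub).trans ((measure_union_le _ _).trans ?_)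
  rw [hE₀, zero_add]
  exact (measure_union_le _ _).trans (add_le_add ((measure_union_le _ _).trans
    (add_le_add le_rfl hE₂)) hE₃)

theorem tendsto_measure_gt {f : Ω → ℝ} (hf : Measurable f) {x : ℕ → ℝ}
    (hx : Tendsto x atTop atTop) : Tendsto (fun n => P {ω | x n < f ω}) atTop (𝓝 0) := by
  have h := tendsto_measure_iInter_atTop (μ := P) (s := fun y : ℝ => {ω | y < f ω})
    (fun y => (measurableSet_lt measurable_const hf).nullMeasurableSet)
    (fun y z hyz ω hω => lt_of_le_of_lt hyz hω) ⟨0, measure_ne_top _ _⟩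
  have h0 : (⋂ y : ℝ, {ω | y < f ω}) = ∅ := by
    ext ω
    simp only [Set.mem_iInter, Set.mem_ofPred_eq, Set.mem_empty_iff_false, iff_false, not_forall,
      not_lt]
    exact ⟨f ω, le_rfl⟩
  rw [h0, measure_empty] at h
  exact h.comp hx

theorem tendsto_sq_mul_exp_neg_rpow {γ b : ℝ} (hγ : 0 < γ) (hb : 0 < b) :
    Tendsto (fun x : ℝ => x ^ 2 * Real.exp (-(b * x ^ γ))) atTop (𝓝 0) := by
  have := (tendsto_rpow_mul_exp_neg_mul_atTop_nhds_zero (2 / γ) b hb).comp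
    (tendsto_rpow_atTop hγ)
  refine this.congr' ?_
  filter_upwards [eventually_ge_atTop 0] with x hx
  simp only [Function.comp]
  rw [← Real.rpow_mul hx, mul_div_cancel₀ _ hγ.ne', Real.rpow_two, neg_mul]

theorem tendsto_measure_sum_deviation (hu : IsDelayedRenewalSequence P u) {η C : ℝ} (hη : 0 < η)
    (hC : 0 < C) :
    Tendsto (fun n : ℕ => P {ω | ∃ a b : ℕ, a ≤ b ∧ b ≤ ⌊C * n⌋₊ ∧
        η * (b - a : ℕ) + η * √n < |∑ l ∈ Finset.Ico a b, u l ω - (b - a : ℕ)|})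
      atTop (𝓝 0) := by
  obtain ⟨δ, hδ, hmom⟩ := hu.moment
  have hp : 0 < 2 + δ := by linarith
  -- With this exponent, n · n^(-α(2+δ)) = n^(-δ/4) tends to zero, and α < 1/2 makes n² exp(-c
  -- n^(1/2-α)) tend to zero.
  set α := (1 + δ / 4) / (2 + δ) with hα
  have hα0 : 0 < α := by positivity
  have hα2 : α < 1 / 2 := by
    rw [hα, div_lt_iff₀ hp]
    linarith
  have hαp : α * (2 + δ) = 1 + δ / 4 := div_mul_cancel₀ _ hp.ne'
  set c := ∫ ω, ‖u 1 ω‖ ^ (2 + δ) ∂P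
  have hc : 0 ≤ c := integral_nonneg fun ω => by positivity
  have hn : Tendsto (fun n : ℕ => (n : ℝ)) atTop atTop := tendsto_natCast_atTop_atTop
  have hx : Tendsto (fun n : ℕ => η / 3 * √n) atTop atTop :=
    (Real.tendsto_sqrt_atTop.comp hn).const_mul_atTop (by positivity)
  have h1 : Tendsto (fun n : ℕ => P {ω | η / 3 * √n < u 0 ω}) atTop (𝓝 0) :=
    tendsto_measure_gt (hu.measurable 0) hx
  have h2 : Tendsto (fun n : ℕ => ENNReal.ofReal (C * c * (n : ℝ) ^ (-(δ / 4)))) atTop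
      (𝓝 0) := by
    have := ((tendsto_rpow_neg_atTop (y := δ / 4) (by positivity)).comp hn).const_mul (C * c)
    rw [mul_zero] at this
    simpa using ENNReal.tendsto_ofReal this
  have h3 : Tendsto (fun n : ℕ => ENNReal.ofReal (2 * (C + 1) ^ 2 *
      ((n : ℝ) ^ 2 * Real.exp (-(η / 3 * (n : ℝ) ^ (1 / 2 - α)))))) atTop (𝓝 0) := by
    have := ((tendsto_sq_mul_exp_neg_rpow (γ := 1 / 2 - α) (b := η / 3) (by linarith)
      (by positivity)).comp hn).const_mul (2 * (C + 1) ^ 2)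
    rw [mul_zero] at this
    simpa using ENNReal.tendsto_ofReal this
  have h4 := (h1.add h2).add h3
  simp only [add_zero] at h4
  refine tendsto_of_tendsto_of_tendsto_of_le_of_le' tendsto_const_nhds h4
    (.of_forall fun _ => zero_le) ?_
  have h5 : ∀ᶠ n : ℕ in atTop, ((n : ℝ) ^ α)⁻¹ * ∫ ω, u 1 ω ^ 2 ∂P ≤ η := by
    have := ((tendsto_rpow_atTop hα0).comp hn).inv_tendsto_atTop.mul_const
      (∫ ω, u 1 ω ^ 2 ∂P)
    rw [zero_mul] at this
    exact this.eventually_le_const hη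
  filter_upwards [h5, hx.eventually_ge_atTop 1, eventually_ge_atTop 1] with n hn1 hn2 hn3
  have hn0 : (0 : ℝ) < n := by exact_mod_cast hn3
  have hn1' : (1 : ℝ) ≤ n := by exact_mod_cast hn3
  have hM : (⌊C * n⌋₊ : ℝ) ≤ C * n := Nat.floor_le (by positivity)
  have key := hu.measure_sum_deviation_le hp hmom (Real.rpow_pos_of_pos hn0 α) hn1 hn2 ⌊C * n⌋₊
  have h6 : 3 * (η / 3 * √n) = η * √n := by ring
  rw [h6] at key
  refine key.trans (add_le_add (add_le_add le_rfl ?_) ?_)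
  · rw [← ENNReal.ofReal_natCast, ← ENNReal.ofReal_mul (by positivity)]
    refine ENNReal.ofReal_le_ofReal ?_
    rw [← Real.rpow_mul hn0.le, hαp]
    calc (⌊C * n⌋₊ : ℝ) * (c / (n : ℝ) ^ (1 + δ / 4))
        ≤ C * n * (c / (n : ℝ) ^ (1 + δ / 4)) := by gcongr
      _ = C * c * (n : ℝ) ^ (-(δ / 4)) := by
        rw [Real.rpow_add hn0, Real.rpow_one, Real.rpow_neg hn0.le]
        field_simp
  · have h7 : ((n : ℝ) ^ α)⁻¹ * (η / 3 * √n) = η / 3 * (n : ℝ) ^ (1 / 2 - α) := by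
      rw [Real.rpow_sub hn0, ← Real.sqrt_eq_rpow]
      ring
    have h8 : ((⌊C * n⌋₊ : ℝ≥0∞) + 1) = ENNReal.ofReal (⌊C * n⌋₊ + 1) := by
      rw [ENNReal.ofReal_add (by positivity) zero_le_one, ENNReal.ofReal_natCast,
        ENNReal.ofReal_one]
    rw [h7, h8, ← ENNReal.ofReal_ofNat, ← ENNReal.ofReal_mul (by norm_num),
      ← ENNReal.ofReal_mul (by positivity), ← ENNReal.ofReal_mul (by positivity)]
    refine ENNReal.ofReal_le_ofReal ?_
    have h9 : (⌊C * n⌋₊ : ℝ) + 1 ≤ (C + 1) * n := by linarith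
    calc _ = 2 * ((⌊C * n⌋₊ : ℝ) + 1) ^ 2 * Real.exp (-(η / 3 * (n : ℝ) ^ (1 / 2 - α))) := by
          ring
      _ ≤ 2 * ((C + 1) * n) ^ 2 * Real.exp (-(η / 3 * (n : ℝ) ^ (1 / 2 - α))) := by gcongr
      _ = _ := by ring

end IsDelayedRenewalSequence

/-- Inversion through U(χ(t)) ≤ t < U(χ(t) + 1), where U denotes the partial sums. The assumption 1
≤ ηw absorbs the off-by-one terms, and `hM` forces U(M) > c, so that only indices up to M occur. -/
theorem abs_renewalCount_sub_le {Ω : Type*} {u : ℕ → Ω → ℝ} {ω : Ω} (hu : ∀ l, 0 ≤ u l ω)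
    {η c w : ℝ} {M : ℕ} (hη : 0 < η) (hη4 : η ≤ 1 / 4) (hw : 1 ≤ η * w)
    (hdev : ∀ a b : ℕ, a ≤ b → b ≤ M →
      |∑ l ∈ Finset.Ico a b, u l ω - (b - a : ℕ)| ≤ η * (b - a : ℕ) + η * w)
    (hM : c + w < 3 / 4 * M) {s t : ℝ≥0} (hst : s ≤ t) (ht : t ≤ c) :
    |((renewalCount u t ω : ℝ) - renewalCount u s ω) - (t - s)| ≤
      2 * η * (t - s) + 3 * η * w := by
  set U : ℕ → ℝ := fun m => ∑ l ∈ Finset.range m, u l ω with hU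
  have hUm : Monotone U := fun m m' h =>
    Finset.sum_le_sum_of_subset_of_nonneg (Finset.range_subset_range.2 h) fun l _ _ => hu l
  have hw0 : 0 < w := by
    by_contra h
    nlinarith
  have hUd : ∀ a b, a ≤ b → b ≤ M → |U b - U a - (b - a)| ≤ η * (b - a) + η * w := by
    intro a b hab hb
    have := hdev a b hab hb
    rwa [Finset.sum_Ico_eq_sub _ hab, Nat.cast_sub hab] at this
  have hUM : c < U M := by
    have := (abs_le.1 (hUd 0 M (Nat.zero_le _) le_rfl)).1
    simp only [hU, Finset.range_zero, Finset.sum_empty, Nat.cast_zero, sub_zero] at this ⊢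
    have h2 : η * M ≤ 1 / 4 * M := by gcongr
    have h3 : η * w ≤ 1 / 4 * w := by gcongr
    linarith
  have hcount : ∀ x : ℝ≥0, x ≤ c → renewalCount u x ω < M ∧ U (renewalCount u x ω) ≤ x ∧
      x < U (renewalCount u x ω + 1) := by
    intro x hx
    have hb : ∀ m, U m ≤ x → m < M := fun m hm => by
      by_contra h
      have := hUm (not_lt.1 h)
      linarith
    -- Boundedness makes the supremum a genuine maximum; for an unbounded set of naturals `sSup`
    -- would be 0.
    have hbdd : BddAbove {m : ℕ | U m ≤ x} := ⟨M, fun m hm => (hb m hm).le⟩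
    have hmem : renewalCount u x ω ∈ {m : ℕ | U m ≤ x} :=
      Nat.sSup_mem ⟨0, by simp [hU]⟩ hbdd
    refine ⟨hb _ hmem, hmem, ?_⟩
    by_contra h
    have := le_csSup hbdd (show renewalCount u x ω + 1 ∈ {m : ℕ | U m ≤ x} from not_lt.1 h)
    have h2 : sSup {m : ℕ | U m ≤ x} = renewalCount u x ω := rfl
    omega
  have hst' : (s : ℝ) ≤ t := hst
  obtain ⟨ha1, ha2, ha3⟩ := hcount s (hst'.trans ht)
  obtain ⟨hb1, hb2, hb3⟩ := hcount t ht
  set a := renewalCount u s ω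
  set b := renewalCount u t ω
  have hab : a ≤ b := by
    by_contra h
    have := hUm (show b + 1 ≤ a by omega)
    linarith
  have hab' : (a : ℝ) ≤ b := by exact_mod_cast hab
  have e1 := (abs_le.1 (hUd a (b + 1) (by omega) hb1)).2
  push_cast at e1
  set τ := (t : ℝ) - s
  have f1 : τ ≤ (1 + η) * (b - a + 1) + η * w := by
    simp only [τ]
    linarith
  have hτ : 0 ≤ τ := sub_nonneg.2 hst'
  have f2 : (1 - η) * (b - a - 1) - η * w ≤ τ := by
    rcases hab.eq_or_lt with h | h
    · rw [← h, sub_self, zero_sub]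
      linarith
    · have e3 := (abs_le.1 (hUd (a + 1) b h hb1.le)).1
      push_cast at e3
      simp only [τ]
      linarith
  set d := (b : ℝ) - a
  rw [abs_le]
  constructor
  · by_contra hcon
    have g : d + 1 < τ - 2 * η * τ - 3 * η * w + 1 := by linarith
    have : (1 + η) * (d + 1) ≤ (1 + η) * (τ - 2 * η * τ - 3 * η * w + 1) :=
      mul_le_mul_of_nonneg_left g.le (by linarith)
    nlinarith [mul_nonneg hη.le hτ, mul_nonneg (mul_nonneg hη.le hη.le) hτ,
      mul_nonneg (mul_nonneg hη.le hη.le) hw0.le]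
  · by_contra hcon
    have g : τ + 2 * η * τ + 3 * η * w - 1 < d - 1 := by linarith
    have : (1 - η) * (τ + 2 * η * τ + 3 * η * w - 1) ≤ (1 - η) * (d - 1) :=
      mul_le_mul_of_nonneg_left g.le (by linarith)
    have h1 : 0 ≤ η * τ * (1 - 2 * η) := by
      have : 0 ≤ 1 - 2 * η := by linarith
      positivity
    have h2 : 0 ≤ η * w * (1 / 4 - η) := by
      have : 0 ≤ 1 / 4 - η := by linarith
      positivity
    nlinarith

theorem IsDelayedRenewalSequence.tendsto_measure_renewalCount_deviation {Ω : Type*}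
    [MeasurableSpace Ω] {P : Measure Ω} [IsProbabilityMeasure P] {u : ℕ → Ω → ℝ}
    (hu : IsDelayedRenewalSequence P u) {η c : ℝ} (hη : 0 < η) (hc : 0 < c) :
    Tendsto (fun n : ℕ => P {ω | ∃ s t : ℝ≥0, s ≤ t ∧ t ≤ c * n ∧
        η * (t - s) + η * √n <
          |((renewalCount u t ω : ℝ) - renewalCount u s ω) - (t - s)|}) atTop (𝓝 0) := by
  set κ := min (η / 3) (1 / 4) with hκ
  have hκ0 : 0 < κ := by positivity
  have hκ3 : 3 * κ ≤ η := by
    have := min_le_left (η / 3) (1 / 4)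
    linarith
  refine tendsto_of_tendsto_of_tendsto_of_le_of_le' tendsto_const_nhds
    -- The factor 2c + 4 leaves room for 3/4 of the rounded-down index bound to exceed cn + √n.
    (hu.tendsto_measure_sum_deviation hκ0 (show 0 < 2 * c + 4 by positivity))
    (.of_forall fun _ => zero_le) ?_
  have hx : Tendsto (fun n : ℕ => κ * √n) atTop atTop :=
    (Real.tendsto_sqrt_atTop.comp tendsto_natCast_atTop_atTop).const_mul_atTop hκ0
  filter_upwards [hx.eventually_ge_atTop 1, eventually_ge_atTop 1] with n hn1 hn2
  have hn2' : (1 : ℝ) ≤ n := by exact_mod_cast hn2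
  have hsq : √(n : ℝ) ≤ n := by
    rw [Real.sqrt_le_left (by linarith)]
    nlinarith
  refine measure_mono_ae ?_
  filter_upwards [ae_all_iff.2 hu.nonneg] with ω hω
  rintro ⟨s, t, hst, ht, hlt⟩
  by_contra hnot
  have hnot' : ∀ a b : ℕ, a ≤ b → b ≤ ⌊(2 * c + 4) * n⌋₊ →
      |∑ l ∈ Finset.Ico a b, u l ω - (b - a : ℕ)| ≤ κ * (b - a : ℕ) + κ * √n := by
    intro a b hab hb
    by_contra h
    exact hnot ⟨a, b, hab, hb, not_le.1 h⟩
  have hfl := Nat.lt_floor_add_one ((2 * c + 4) * n)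
  have key := abs_renewalCount_sub_le hω hκ0 (min_le_right _ _) hn1 hnot' (c := c * n) (by
    have : 0 < c * n := by positivity
    linarith) hst ht
  have hst' : (0 : ℝ) ≤ t - s := sub_nonneg.2 hst
  have g1 : 2 * κ * (t - s) ≤ η * (t - s) := by
    gcongr
    linarith
  have g2 : 3 * κ * √n ≤ η * √n := by gcongr
  linarith

/-! ### Path properties -/

theorem IsCadlag.measurable {f : ℝ≥0 → ℕ} (hf : IsCadlag f) : Measurable f := by
  refine measurable_of_tendsto_metrizable
    (f := fun (l : ℕ) (x : ℝ≥0) => f ((⌈x * (l + 1)⌉₊ : ℝ≥0) / (l + 1))) (fun l => ?_) ?_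
  · have h1 : Measurable fun x : ℝ≥0 => ⌈x * ((l : ℝ≥0) + 1)⌉₊ :=
      Nat.measurable_ceil.comp (measurable_id.mul_const _)
    exact (measurable_from_top (f := fun m : ℕ => f ((m : ℝ≥0) / (l + 1)))).comp h1
  · exact tendsto_pi_nhds.2 fun x =>
      (hf.right_cont x).tendsto.comp (tendsto_ceil_mul_div x)

namespace SystemSeq

variable {I J Ω : Type*} {X : SystemSeq I J Ω}

theorem serverT_zero (r : ℕ) (i : I) (j : J) (k : Fin (X.n r i)) (ω : Ω) :
    X.serverT r i j k 0 ω = 0 := by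
  simp [serverT]

namespace IsPath

variable [Fintype I] [Fintype J] {skill : I → J → Prop} {r : ℕ} {ω : Ω}

theorem B_le_one (h : X.IsPath skill r ω) (i : I) (j : J) (k : Fin (X.n r i)) (t : ℝ≥0) :
    X.B r i j k t ω ≤ 1 :=
  (Finset.single_le_sum (f := fun j => X.B r i j k t ω) (fun _ _ => Nat.zero_le _)
    (Finset.mem_univ j)).trans (h.busy_le_one i k t)

theorem serverT_sub_mem (h : X.IsPath skill r ω) (i : I) (j : J) (k : Fin (X.n r i))
    {s t : ℝ≥0} (hst : s ≤ t) :
    X.serverT r i j k t ω - X.serverT r i j k s ω ∈ Set.Icc 0 ((t : ℝ) - s) := by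
  -- Measurability and boundedness ensure that the integrals are genuine and not the default value
  -- 0.
  have hm : Measurable fun x : ℝ => (X.B r i j k x.toNNReal ω : ℝ) :=
    (measurable_from_top (f := fun n : ℕ => (n : ℝ))).comp
      ((h.cadlag_B i j k).measurable.comp measurable_real_toNNReal)
  have hb : ∀ x : ℝ, ‖(X.B r i j k x.toNNReal ω : ℝ)‖ ≤ 1 := fun x => by
    rw [Real.norm_of_nonneg (Nat.cast_nonneg _)]
    exact_mod_cast h.B_le_one i j k _
  have hi : ∀ a b : ℝ, IntervalIntegrable (fun x : ℝ => (X.B r i j k x.toNNReal ω : ℝ))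
      volume a b := fun a b =>
    (intervalIntegrable_const (c := (1 : ℝ))).mono_fun hm.aestronglyMeasurable
      (.of_forall fun x => by simpa using hb x)
  have hst' : (s : ℝ) ≤ t := hst
  rw [serverT, serverT, intervalIntegral.integral_interval_sub_left (hi _ _) (hi _ _)]
  refine ⟨intervalIntegral.integral_nonneg hst' fun x _ => Nat.cast_nonneg _, ?_⟩
  have := intervalIntegral.norm_integral_le_of_norm_le_const (a := (s : ℝ)) (b := t)
    (f := fun x : ℝ => (X.B r i j k x.toNNReal ω : ℝ)) (C := 1) fun x _ => hb x
  rw [one_mul, abs_of_nonneg (sub_nonneg.2 hst')] at this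
  exact (Real.le_norm_self _).trans this

theorem serverT_nonneg (h : X.IsPath skill r ω) (i : I) (j : J) (k : Fin (X.n r i)) (t : ℝ≥0) :
    0 ≤ X.serverT r i j k t ω := by
  simpa [serverT_zero] using (h.serverT_sub_mem i j k (zero_le : (0 : ℝ≥0) ≤ t)).1

theorem serverT_le (h : X.IsPath skill r ω) (i : I) (j : J) (k : Fin (X.n r i)) (t : ℝ≥0) :
    X.serverT r i j k t ω ≤ t := by
  simpa [serverT_zero] using (h.serverT_sub_mem i j k (zero_le : (0 : ℝ≥0) ≤ t)).2

theorem serverT_eq_zero (h : X.IsPath skill r ω) {i : I} {j : J} (hij : ¬ skill i j)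
    (k : Fin (X.n r i)) (t : ℝ≥0) : X.serverT r i j k t ω = 0 := by
  simp [serverT, h.skill_B i j k _ hij]

theorem Z_le (h : X.IsPath skill r ω) (i : I) (j : J) (t : ℝ≥0) : X.Z r i j t ω ≤ X.n r i := by
  refine (Finset.sum_le_card_nsmul _ _ 1 fun k _ => h.B_le_one i j k t).trans ?_
  simp

theorem sum_Z_le (h : X.IsPath skill r ω) (i : I) (t : ℝ≥0) :
    ∑ j, X.Z r i j t ω ≤ X.n r i := by
  simp only [Z]
  rw [Finset.sum_comm]
  refine (Finset.sum_le_card_nsmul _ _ 1 fun k _ => h.busy_le_one i k t).trans ?_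
  simp

theorem T_sub_mem (h : X.IsPath skill r ω) (i : I) (j : J) {s t : ℝ≥0} (hst : s ≤ t) :
    X.T r i j t ω - X.T r i j s ω ∈ Set.Icc 0 (X.n r i * ((t : ℝ) - s)) := by
  rw [T, T, ← Finset.sum_sub_distrib]
  refine ⟨Finset.sum_nonneg fun k _ => (h.serverT_sub_mem i j k hst).1, ?_⟩
  refine (Finset.sum_le_card_nsmul _ _ _ fun k _ => (h.serverT_sub_mem i j k hst).2).trans ?_
  simp

/-- The delayed customers of class `j` who start service in pool `i` during `(s, t]` either
arrived during that time, or replace customers who left pool `i` during that time. -/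
theorem C_sub_le (h : X.IsPath skill r ω)
    (hD : ∀ i j, Monotone fun t => X.D r i j t ω) (hA : ∀ j, Monotone fun t => X.A r j t ω)
    (i : I) (j : J) {s t : ℝ≥0} (hst : s ≤ t) :
    (X.C r i j t ω : ℝ) - X.C r i j s ω ≤ ((X.A r j t ω : ℝ) - X.A r j s ω) +
      ∑ j', ((X.D r i j' t ω : ℝ) - X.D r i j' s ω) := by
  have hDn : 0 ≤ ∑ j', ((X.D r i j' t ω : ℝ) - X.D r i j' s ω) :=
    Finset.sum_nonneg fun j' _ => sub_nonneg.2 (by exact_mod_cast hD i j' hst)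
  have hAn : (0 : ℝ) ≤ (X.A r j t ω : ℝ) - X.A r j s ω :=
    sub_nonneg.2 (by exact_mod_cast hA j hst)
  have hCm : ∀ i j, (0 : ℝ) ≤ (X.C r i j t ω : ℝ) - X.C r i j s ω := fun i j =>
    sub_nonneg.2 (by exact_mod_cast h.mono_C i j hst)
  by_cases hij : skill i j
  · have hni := h.non_idling i j s hij
    -- Only the state at time s matters. An empty queue cannot release more customers than join it
    -- later; a full pool cannot take in more than it releases, since the total of Z in the pool
    -- cannot grow.
    rcases mul_eq_zero.1 hni with hQ | hI
    · have hC : (X.C r i j t ω : ℝ) - X.C r i j s ω ≤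
          ∑ i, ((X.C r i j t ω : ℝ) - X.C r i j s ω) :=
        Finset.single_le_sum (f := fun i => (X.C r i j t ω : ℝ) - X.C r i j s ω)
          (fun i _ => hCm i j) (Finset.mem_univ i)
      have q1 : (X.Q r j t ω : ℝ) + ∑ i, (X.C r i j t ω : ℝ) = X.Q r j 0 ω + X.Aq r j t ω := by
        exact_mod_cast h.queue j t
      have q2 : (X.Q r j s ω : ℝ) + ∑ i, (X.C r i j s ω : ℝ) = X.Q r j 0 ω + X.Aq r j s ω := by
        exact_mod_cast h.queue j s
      have a1 : (X.A r j t ω : ℝ) = X.Aq r j t ω + ∑ i, (X.As r i j t ω : ℝ) := by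
        exact_mod_cast h.arrivals j t
      have a2 : (X.A r j s ω : ℝ) = X.Aq r j s ω + ∑ i, (X.As r i j s ω : ℝ) := by
        exact_mod_cast h.arrivals j s
      have a3 : ∑ i, (X.As r i j s ω : ℝ) ≤ ∑ i, (X.As r i j t ω : ℝ) :=
        Finset.sum_le_sum fun i _ => by exact_mod_cast h.mono_As i j hst
      have hQ' : (X.Q r j s ω : ℝ) = 0 := by exact_mod_cast hQ
      have hQt : (0 : ℝ) ≤ X.Q r j t ω := Nat.cast_nonneg _
      rw [Finset.sum_sub_distrib] at hC
      linarith
    · have hC : (X.C r i j t ω : ℝ) - X.C r i j s ω ≤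
          ∑ j, ((X.C r i j t ω : ℝ) - X.C r i j s ω) :=
        Finset.single_le_sum (f := fun j => (X.C r i j t ω : ℝ) - X.C r i j s ω)
          (fun j _ => hCm i j) (Finset.mem_univ j)
      have hb : ∀ j', (X.C r i j' t ω : ℝ) - X.C r i j' s ω ≤
          ((X.Z r i j' t ω : ℝ) - X.Z r i j' s ω) +
            ((X.D r i j' t ω : ℝ) - X.D r i j' s ω) := fun j' => by
        have b1 : (X.Z r i j' t ω : ℝ) + X.D r i j' t ω =
            X.Z r i j' 0 ω + X.As r i j' t ω + X.C r i j' t ω := by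
          exact_mod_cast h.busy i j' t
        have b2 : (X.Z r i j' s ω : ℝ) + X.D r i j' s ω =
            X.Z r i j' 0 ω + X.As r i j' s ω + X.C r i j' s ω := by
          exact_mod_cast h.busy i j' s
        have b3 : (X.As r i j' s ω : ℝ) ≤ X.As r i j' t ω := by
          exact_mod_cast h.mono_As i j' hst
        linarith
      have hZ := hC.trans (Finset.sum_le_sum fun j' _ => hb j')
      rw [Finset.sum_add_distrib, Finset.sum_sub_distrib] at hZ
      have z1 : ∑ j', (X.Z r i j' t ω : ℝ) ≤ X.n r i := by exact_mod_cast h.sum_Z_le i t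
      have z2 : (X.n r i : ℝ) - ∑ j', (X.Z r i j' s ω : ℝ) = 0 := by
        have := hI
        rw [idle] at this
        exact_mod_cast this
      linarith
  · rw [h.skill_C i j t hij, h.skill_C i j s hij]
    simp only [Nat.cast_zero, sub_self]
    linarith

end IsPath

/-! ### Departures -/

section Departures

variable [Fintype I] [Fintype J] [MeasurableSpace Ω] {P : Measure Ω} {skill : I → J → Prop}
  {p q : I → J → ℝ}

theorem IsParallelRandomServer.ae_μ_mem (hX : X.IsParallelRandomServer skill p q P) :
    ∀ᵐ ω ∂P, ∀ i j k, skill i j → X.μ i j k ω ∈ Set.Icc (p i j) (q i j) := by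
  refine ae_all_iff.2 fun i => ae_all_iff.2 fun j => ae_all_iff.2 fun k => ?_
  by_cases h : skill i j
  · filter_upwards [hX.μ_mem i j k h] with ω hω _ using hω
  · exact .of_forall fun ω hs => absurd hs h

theorem IsParallelRandomServer.ae_monotone_D (hX : X.IsParallelRandomServer skill p q P) (r : ℕ) :
    ∀ᵐ ω ∂P, ∀ i j, Monotone fun t => X.D r i j t ω := by
  filter_upwards [hX.ae_μ_mem, hX.path r] with ω hμ hp i j s t hst
  refine Finset.sum_le_sum fun k _ => ?_
  -- For incapable pairs the sign of the rate is not controlled, but their busy time vanishes.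
  by_cases h : skill i j
  · refine (hX.poisson i j k).mono ω (Real.toNNReal_le_toNNReal ?_)
    exact mul_le_mul_of_nonneg_left (sub_nonneg.1 (hp.serverT_sub_mem i j k hst).1)
      ((hX.p_pos i j h).le.trans (hμ i j k h).1)
  · simp only [serverD, hp.serverT_eq_zero h]
    exact le_rfl

variable [IsProbabilityMeasure P]

/-- Nonanticipation is a statement about all clocks jointly, so the stopping vector must contain
every server of every pool and every class; the sum then selects one pool and one class. -/
theorem IsParallelRandomServer.measure_stopped_service_le
    (hX : X.IsParallelRandomServer skill p q P) (r : ℕ) (i : I) (j : J) (t h : ℝ≥0) (c : ℝ) :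
    P {ω | c ≤ ∑ k : Fin (X.n r i),
      ((X.S i j k ((X.μ i j k ω * X.serverT r i j k t ω).toNNReal + h) ω -
        X.S i j k (X.μ i j k ω * X.serverT r i j k t ω).toNNReal ω : ℕ) : ℝ)} ≤
      ENNReal.ofReal (Real.exp (X.n r i * (h * (Real.exp 1 - 1)) - c)) := by
  classical
  have hpi := hX.poisson_indep
  have hpo := hX.poisson
  obtain ⟨G, hG, hind, -, -, -, -, hT⟩ := hX.nonanticipating r
  let ι := Σ i : I, J × Fin (X.n r i)
  let W : ι → ℝ≥0 → Ω → ℕ := fun a => X.S a.1 a.2.1 a.2.2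
  let σ : ι → Ω → ℝ≥0 := fun a ω =>
    (X.μ a.1 a.2.1 a.2.2 ω * X.serverT r a.1 a.2.1 a.2.2 t ω).toNNReal
  have hWi : iIndepFun (fun k ω t => W k t ω) P := by
    refine hpi.precomp (g := fun a : ι => (a.1, a.2.1, (a.2.2 : ℕ))) ?_
    rintro ⟨i, j, k⟩ ⟨i', j', k'⟩ hab
    simp only [Prod.mk.injEq] at hab
    obtain ⟨rfl, rfl, hk⟩ := hab
    rw [Fin.ext hk]
  have hGW : Indep G (⨆ (k : ι) (s : ℝ≥0), MeasurableSpace.comap (W k s) ⊤) P := by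
    refine indep_of_indep_of_le_right hind (iSup₂_le fun a s => ?_)
    exact le_iSup_of_le a.1 (le_iSup_of_le a.2.1 (le_iSup_of_le (a.2.2 : ℕ)
      (le_iSup_of_le s le_rfl)))
  have hσ : ∀ a : ι → ℝ≥0, MeasurableSet[pastInfo G W a] {ω | ∀ k, σ k ω ≤ a k} := by
    intro a
    let τ : I → J → ℕ → ℝ≥0 := fun i j k =>
      if hk : k < X.n r i then a ⟨i, j, ⟨k, hk⟩⟩ else 0
    have hτ : ∀ i j (k : Fin (X.n r i)), τ i j k = a ⟨i, j, k⟩ := fun i j k => by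
      simp [τ, k.2]
    have h1 := hT t τ
    simp only [hτ] at h1
    have h2 : {ω | ∀ k, σ k ω ≤ a k} = {ω | ∀ i j (k : Fin (X.n r i)),
        X.μ i j k ω * X.serverT r i j k t ω ≤ a ⟨i, j, k⟩} := by
      ext ω
      simp only [σ, Set.mem_ofPred_eq, Real.toNNReal_le_iff_le_coe]
      exact ⟨fun h i j k => h ⟨i, j, k⟩, fun h k => h k.1 k.2.1 k.2.2⟩
    rw [h2]
    refine (sup_le_sup_left ?_ G : _ ≤ pastInfo G W a) _ h1
    refine iSup_le fun i => iSup_le fun j => iSup_le fun k => iSup₂_le fun s hs => ?_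
    exact le_iSup_of_le (⟨i, j, k⟩ : ι) (le_iSup₂_of_le
      (f := fun s (_ : s ≤ a ⟨i, j, k⟩) => MeasurableSpace.comap (W ⟨i, j, k⟩ s) ⊤) s
      (hs.trans (hτ i j k).le) le_rfl)
  have hinj : Function.Injective fun k : Fin (X.n r i) => (⟨i, j, k⟩ : ι) := by
    intro k k' hkk
    simpa using hkk
  have key := measure_stopped_increments_le (fun a : ι => hpo a.1 a.2.1 a.2.2) hWi hG hGW hσ
    (Finset.univ.map ⟨_, hinj⟩) h c
  simpa only [Finset.sum_map, Finset.card_map, Finset.card_univ, Fintype.card_fin,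
    Function.Embedding.coeFn_mk, W, σ] using key

/-- During time h the clock μT of a server advances by at most bh. Extending every clock by exactly
bh can only add jumps, and it makes the increments Poisson with a deterministic mean. -/
theorem IsParallelRandomServer.measure_D_increment_le
    (hX : X.IsParallelRandomServer skill p q P) (r : ℕ) {i : I} {j : J} (hij : skill i j)
    {b : ℝ≥0} (hb : q i j ≤ b) (t h : ℝ≥0) (c : ℝ) :
    P {ω | c ≤ (X.D r i j (t + h) ω : ℝ) - X.D r i j t ω} ≤
      ENNReal.ofReal (Real.exp (X.n r i * (b * h * (Real.exp 1 - 1)) - c)) := by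
  refine le_trans (measure_mono_ae ?_)
    (by simpa using hX.measure_stopped_service_le r i j t (b * h) c)
  filter_upwards [hX.ae_μ_mem, hX.path r] with ω hμ hp hω
  refine le_trans (show c ≤ _ from hω) ?_
  rw [D, D, Nat.cast_sum, Nat.cast_sum, ← Finset.sum_sub_distrib]
  refine Finset.sum_le_sum fun k _ => ?_
  rw [Nat.cast_sub ((hX.poisson i j k).mono ω le_self_add)]
  refine sub_le_sub_right (Nat.cast_le.2 ((hX.poisson i j k).mono ω ?_)) _
  have h1 := (hp.serverT_sub_mem i j k (le_self_add : t ≤ t + h)).2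
  have h2 := hμ i j k hij
  have h3 : 0 ≤ X.μ i j k ω := (hX.p_pos i j hij).le.trans h2.1
  rw [← NNReal.coe_le_coe, NNReal.coe_add, Real.coe_toNNReal _
    (mul_nonneg h3 (hp.serverT_nonneg i j k _)), Real.coe_toNNReal _
    (mul_nonneg h3 (hp.serverT_nonneg i j k _)), NNReal.coe_mul]
  push_cast at h1
  have h4 : X.μ i j k ω * (X.serverT r i j k (t + h) ω - X.serverT r i j k t ω) ≤ b * h :=
    mul_le_mul (h2.2.trans hb) (by linarith) (hp.serverT_sub_mem i j k le_self_add).1 b.2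
  linarith

/-- A monotone path whose increments over the cells of a grid of width `h` are at most `N h`
has increments at most `N (t - s) + 2 N h`. -/
theorem sub_le_of_grid {f : ℝ≥0 → ℕ} (hf : Monotone f) {h K : ℝ≥0} {N : ℝ}
    (hh : 0 < h) (hN : 0 ≤ N)
    (hgrid : ∀ l ≤ ⌊K / h⌋₊, (f (l * h + h) : ℝ) - f (l * h) ≤ N * h) {s t : ℝ≥0} (hst : s ≤ t)
    (ht : t ≤ K) : (f t : ℝ) - f s ≤ N * (t - s) + 2 * (N * h) := by
  set a := ⌊s / h⌋₊
  set b := ⌊t / h⌋₊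
  have hab : a ≤ b := Nat.floor_mono (div_le_div_of_nonneg_right hst hh.le)
  have hbK : b ≤ ⌊K / h⌋₊ := Nat.floor_mono (div_le_div_of_nonneg_right ht hh.le)
  have ha1 : (a : ℝ≥0) * h ≤ s := (le_div_iff₀ hh).1 (Nat.floor_le zero_le)
  have ha2 : s ≤ (a : ℝ≥0) * h + h := by
    have := (div_lt_iff₀ hh).1 (Nat.lt_floor_add_one (s / h))
    rw [add_mul, one_mul] at this
    exact this.le
  have hb1 : (b : ℝ≥0) * h ≤ t := (le_div_iff₀ hh).1 (Nat.floor_le zero_le)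
  have hb2 : t ≤ (b : ℝ≥0) * h + h := by
    have := (div_lt_iff₀ hh).1 (Nat.lt_floor_add_one (t / h))
    rw [add_mul, one_mul] at this
    exact this.le
  have hchain : ∀ d, a + d ≤ b → (f ((a + d : ℕ) * h + h) : ℝ) - f (a * h) ≤
      (d + 1) * (N * h) := by
    intro d
    induction d with
    | zero =>
      intro hd
      simpa using hgrid a (hab.trans hbK)
    | succ d ih =>
      intro hd
      have h1 := ih (by omega)
      have h2 := hgrid (a + (d + 1)) (hd.trans hbK)
      have h3 : ((a + (d + 1) : ℕ) : ℝ≥0) * h = (a + d : ℕ) * h + h := by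
        push_cast
        ring
      rw [h3] at h2 ⊢
      push_cast at h1 h2 ⊢
      linarith
  have h1 := hchain (b - a) (by omega)
  rw [Nat.add_sub_cancel' hab, Nat.cast_sub hab] at h1
  have h2 : (f t : ℝ) ≤ f (b * h + h) := by exact_mod_cast hf hb2
  have h3 : (f (a * h) : ℝ) ≤ f s := by exact_mod_cast hf ha1
  have h4 : (b : ℝ) * h ≤ t := by exact_mod_cast hb1
  have h5 : (s : ℝ) ≤ a * h + h := by exact_mod_cast ha2
  have h6 : N * (b * h - a * h) ≤ N * (t - s + h) := mul_le_mul_of_nonneg_left (by linarith) hN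
  linarith

/-- Because e - 1 ≤ 2, the slope 2b + 1 exceeds the Chernoff cost by one: a cell of width h exceeds
its threshold with probability at most exp(-nh). With nh of order √n this beats the O(√n) cells. -/
theorem IsParallelRandomServer.tendsto_measure_D_deviation
    (hX : X.IsParallelRandomServer skill p q P) (htot : Tendsto X.total atTop atTop)
    {i : I} {j : J} {b : ℝ≥0} (hb : q i j ≤ b) {η : ℝ} (hη : 0 < η) (K : ℝ≥0) :
    Tendsto (fun r => P {ω | ∃ s t : ℝ≥0, s ≤ t ∧ t ≤ K ∧
      (2 * b + 1) * X.total r * (t - s) + η * √(X.total r : ℝ) <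
        (X.D r i j t ω : ℝ) - X.D r i j s ω}) atTop (𝓝 0) := by
  by_cases hij : skill i j
  swap
  · refine tendsto_const_nhds.congr fun r => ?_
    symm
    refine measure_mono_null (fun ω hω => ?_) (ae_iff.1 (hX.path r))
    rintro hp
    obtain ⟨s, t, hst, ht, h⟩ := hω
    have hs : (0 : ℝ) ≤ t - s := sub_nonneg.2 hst
    simp only [D, serverD, hp.serverT_eq_zero hij, sub_self] at h
    have : 0 ≤ (2 * b + 1) * X.total r * ((t : ℝ) - s) + η * √(X.total r : ℝ) := by positivity
    linarith
  set N : ℝ := 2 * b + 1 with hN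
  have hN0 : 0 < N := by positivity
  -- Chosen so that the two boundary cells, which cost 2Nnh with nh = κ√n, amount to exactly η√n.
  set κ : ℝ := η / (2 * N) with hκ
  have hκ0 : 0 < κ := by positivity
  have hlim : Tendsto (fun r => ENNReal.ofReal ((K / κ + 1) *
      ((X.total r : ℝ) ^ 2 * Real.exp (-(κ * (X.total r : ℝ) ^ (1 / 2 : ℝ)))))) atTop (𝓝 0) := by
    have := ((IsDelayedRenewalSequence.tendsto_sq_mul_exp_neg_rpow (γ := 1 / 2) (b := κ)
      (by norm_num) hκ0).comp (tendsto_natCast_atTop_atTop.comp htot)).const_mul (K / κ + 1)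
    rw [mul_zero] at this
    simpa using ENNReal.tendsto_ofReal this
  refine tendsto_of_tendsto_of_tendsto_of_le_of_le' tendsto_const_nhds hlim
    (.of_forall fun _ => zero_le) ?_
  filter_upwards [htot.eventually_ge_atTop 1] with r hr
  set n : ℝ := (X.total r : ℝ) with hn
  have hn1 : (1 : ℝ) ≤ n := Nat.one_le_cast.2 hr
  have hsq : 0 < √n := Real.sqrt_pos.2 (by linarith)
  have hsq1 : √n ≤ n := by
    rw [Real.sqrt_le_left (by linarith)]
    nlinarith
  have hsqn : √n * √n = n := Real.mul_self_sqrt (by linarith)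
  set h : ℝ≥0 := (κ / √n).toNNReal with hh
  have hhr : (h : ℝ) = κ / √n := Real.coe_toNNReal _ (by positivity)
  have hh0 : 0 < h := Real.toNNReal_pos.2 (by positivity)
  have hnh : n * h = κ * √n := by
    rw [hhr, mul_div_assoc', div_eq_iff hsq.ne', mul_assoc, hsqn]
    ring
  have hni : (X.n r i : ℝ) ≤ n := by
    have : X.n r i ≤ X.total r :=
      Finset.single_le_sum (f := fun i => X.n r i) (fun _ _ => Nat.zero_le _) (Finset.mem_univ i)
    rw [hn]
    exact_mod_cast this
  set M := ⌊K / h⌋₊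
  have hcell : ∀ l : ℕ, P {ω | N * n * h ≤
      (X.D r i j (l * h + h) ω : ℝ) - X.D r i j (l * h) ω} ≤
      ENNReal.ofReal (Real.exp (-(κ * √n))) := by
    intro l
    refine (hX.measure_D_increment_le r hij hb (l * h) h _).trans ?_
    refine ENNReal.ofReal_le_ofReal (Real.exp_le_exp.2 ?_)
    have he : Real.exp 1 - 1 ≤ 2 := by
      have := Real.exp_one_lt_d9
      linarith
    have h1 : (X.n r i : ℝ) * (b * h * (Real.exp 1 - 1)) ≤ n * (b * h * 2) := by
      have : 0 ≤ Real.exp 1 - 1 := by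
        have := Real.add_one_le_exp 1
        linarith
      gcongr
    rw [hN, ← hnh]
    linarith
  have hsub : P {ω | ∃ s t : ℝ≥0, s ≤ t ∧ t ≤ K ∧ N * n * (t - s) + η * √n <
      (X.D r i j t ω : ℝ) - X.D r i j s ω} ≤
      P (⋃ l ∈ Finset.range (M + 1), {ω | N * n * h ≤
      (X.D r i j (l * h + h) ω : ℝ) - X.D r i j (l * h) ω}) := by
    refine measure_mono_ae ?_
    filter_upwards [hX.ae_monotone_D r] with ω hmono
    rintro ⟨s, t, hst, ht, hlt⟩
    change ω ∈ ⋃ l ∈ Finset.range (M + 1), _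
    by_contra hnot
    simp only [Set.mem_iUnion, Finset.mem_range, not_exists, Set.mem_ofPred_eq, not_le] at hnot
    have := sub_le_of_grid (hmono i j) hh0 (show 0 ≤ N * n by positivity)
      (fun l hl => (hnot l (by omega)).le) hst ht
    have h2 : 2 * (N * n * h) = η * √n := by
      rw [mul_assoc N, hnh, hκ]
      field_simp
    linarith
  refine hsub.trans ((measure_biUnion_finset_le _ _).trans
    ((Finset.sum_le_sum fun l _ => hcell l).trans ?_))
  rw [Finset.sum_const, Finset.card_range, nsmul_eq_mul, ← ENNReal.ofReal_natCast,
    ← ENNReal.ofReal_mul (by positivity), ← Real.sqrt_eq_rpow]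
  refine ENNReal.ofReal_le_ofReal ?_
  rw [← mul_assoc]
  refine mul_le_mul_of_nonneg_right ?_ (Real.exp_pos _).le
  have hM : (M : ℝ) ≤ K / h := by
    have : (M : ℝ≥0) ≤ K / h := Nat.floor_le zero_le
    exact_mod_cast this
  rw [hhr, div_div_eq_mul_div] at hM
  push_cast
  calc (M : ℝ) + 1 ≤ K / κ * √n + 1 := by
        rw [div_mul_eq_mul_div]
        linarith
    _ ≤ K / κ * n ^ 2 + 1 * n ^ 2 := by
        gcongr
        · nlinarith
        · nlinarith
    _ = _ := by ring

end Departures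

end SystemSeq

/-! ### Paths with a linear modulus of continuity up to a small jump -/

/-- The increments of `F` on `[0, K]` are at most `a (t - s) + e`. -/
def HasModulus (F : ℝ≥0 → ℝ) (K : ℝ≥0) (a e : ℝ) : Prop :=
  ∀ s t : ℝ≥0, s ≤ t → t ≤ K → |F t - F s| ≤ a * (t - s) + e

namespace HasModulus

variable {F G : ℝ≥0 → ℝ} {K : ℝ≥0} {a b e f : ℝ}

theorem mono (hF : HasModulus F K a e) (hab : a ≤ b) (hef : e ≤ f) : HasModulus F K b f :=
  fun s t hst ht => (hF s t hst ht).trans (add_le_add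
    (mul_le_mul_of_nonneg_right hab (sub_nonneg.2 hst)) hef)

theorem add (hF : HasModulus F K a e) (hG : HasModulus G K b f) :
    HasModulus (fun t => F t + G t) K (a + b) (e + f) := fun s t hst ht => by
  have h1 := hF s t hst ht
  have h2 := hG s t hst ht
  rw [abs_le] at *
  constructor <;> linarith

theorem neg (hF : HasModulus F K a e) : HasModulus (fun t => -F t) K a e := fun s t hst ht => by
  have h1 := hF s t hst ht
  rw [abs_le] at *
  constructor <;> linarith

theorem sum {ι : Type*} [Fintype ι] {F : ι → ℝ≥0 → ℝ} (hF : ∀ i, HasModulus (F i) K a e) :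
    HasModulus (fun t => ∑ i, F i t) K (Fintype.card ι * a) (Fintype.card ι * e) :=
  fun s t hst ht => by
    rw [← Finset.sum_sub_distrib]
    refine (Finset.abs_sum_le_sum_abs _ _).trans
      ((Finset.sum_le_sum fun i _ => hF i s t hst ht).trans ?_)
    rw [Finset.sum_const, Finset.card_univ, nsmul_eq_mul]
    linarith

theorem of_le (hG : HasModulus G K a e) (h0 : ∀ s t, s ≤ t → 0 ≤ F t - F s)
    (h1 : ∀ s t, s ≤ t → F t - F s ≤ G t - G s) : HasModulus F K a e := fun s t hst ht => by
  rw [abs_of_nonneg (h0 s t hst)]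
  exact (h1 s t hst).trans ((le_abs_self _).trans (hG s t hst ht))

end HasModulus

namespace SystemSeq

variable {I J Ω : Type*} {X : SystemSeq I J Ω} [Fintype I]

theorem n_le_total (X : SystemSeq I J Ω) (r : ℕ) (i : I) : X.n r i ≤ X.total r :=
  Finset.single_le_sum (f := fun i => X.n r i) (fun _ _ => Nat.zero_le _) (Finset.mem_univ i)

variable [Fintype J] {skill : I → J → Prop}

/-- On `[0, K]` the arrivals and departures of the `r`-th system do not deviate much from what
their rates allow for. -/
structure IsRegularPath (X : SystemSeq I J Ω) (skill : I → J → Prop) (r : ℕ) (ω : Ω) (K : ℝ≥0)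
    (b e : ℝ) : Prop where
  isPath : X.IsPath skill r ω
  monotone_D : ∀ i j, Monotone fun t => X.D r i j t ω
  abs_A_le : ∀ j (s t : ℝ≥0), s ≤ t → t ≤ K →
    |((X.A r j t ω : ℝ) - X.A r j s ω) - X.rate r j * (t - s)| ≤
      e * (X.rate r j * (t - s)) + e * √(X.total r : ℝ)
  D_le : ∀ i j (s t : ℝ≥0), s ≤ t → t ≤ K →
    (X.D r i j t ω : ℝ) - X.D r i j s ω ≤
      (2 * b + 1) * X.total r * (t - s) + e * √(X.total r : ℝ)

theorem IsPath.monotone_A {r : ℕ} {ω : Ω} (h : X.IsPath skill r ω) (j : J) :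
    Monotone fun t => X.A r j t ω := fun s t hst => by
  simp only [h.arrivals]
  exact Nat.add_le_add (h.mono_Aq j hst) (Finset.sum_le_sum fun i _ => h.mono_As i j hst)

namespace IsRegularPath

variable {r : ℕ} {ω : Ω} {K : ℝ≥0} {b e : ℝ}

/-- The relative error e ≤ 1 at most doubles the rate, whence the factor 2 in `hrate`. -/
theorem modulus_A (h : X.IsRegularPath skill r ω K b e) (he : e ≤ 1) {j : J} {N₁ : ℝ}
    (hrate : 2 * X.rate r j ≤ N₁ * X.total r) :
    HasModulus (fun t => (X.A r j t ω : ℝ)) K (N₁ * X.total r) (e * √(X.total r : ℝ)) := by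
  intro s t hst ht
  have h1 := h.abs_A_le j s t hst ht
  have h2 : (0 : ℝ) ≤ t - s := sub_nonneg.2 hst
  have h3 : (0 : ℝ) ≤ X.rate r j * (t - s) := mul_nonneg (X.rate r j).2 h2
  have h4 : e * (X.rate r j * (t - s)) ≤ 1 * (X.rate r j * (t - s)) := by gcongr
  have h5 : 2 * X.rate r j * ((t : ℝ) - s) ≤ N₁ * X.total r * (t - s) := by gcongr
  rw [abs_le] at *
  constructor <;> linarith

theorem modulus_D (h : X.IsRegularPath skill r ω K b e) (i : I) (j : J) :
    HasModulus (fun t => (X.D r i j t ω : ℝ)) K ((2 * b + 1) * X.total r)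
      (e * √(X.total r : ℝ)) := by
  intro s t hst ht
  rw [abs_of_nonneg (sub_nonneg.2 (Nat.cast_le.2 (h.monotone_D i j hst)))]
  exact h.D_le i j s t hst ht

theorem modulus_Aq (h : X.IsRegularPath skill r ω K b e) {j : J} {a f : ℝ}
    (hA : HasModulus (fun t => (X.A r j t ω : ℝ)) K a f) :
    HasModulus (fun t => (X.Aq r j t ω : ℝ)) K a f := by
  refine hA.of_le (fun s t hst => sub_nonneg.2 (by exact_mod_cast h.isPath.mono_Aq j hst))
    fun s t hst => ?_
  have : ∑ i, (X.As r i j s ω : ℝ) ≤ ∑ i, (X.As r i j t ω : ℝ) :=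
    Finset.sum_le_sum fun i _ => by exact_mod_cast h.isPath.mono_As i j hst
  simp only [h.isPath.arrivals]
  push_cast
  linarith

theorem modulus_As (h : X.IsRegularPath skill r ω K b e) (i : I) {j : J} {a f : ℝ}
    (hA : HasModulus (fun t => (X.A r j t ω : ℝ)) K a f) :
    HasModulus (fun t => (X.As r i j t ω : ℝ)) K a f := by
  have h0 : ∀ i (s t : ℝ≥0), s ≤ t → (0 : ℝ) ≤ X.As r i j t ω - X.As r i j s ω := fun i s t hst =>
    sub_nonneg.2 (by exact_mod_cast h.isPath.mono_As i j hst)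
  refine hA.of_le (h0 i) fun s t hst => ?_
  have h1 : (X.Aq r j s ω : ℝ) ≤ X.Aq r j t ω := by exact_mod_cast h.isPath.mono_Aq j hst
  have h2 : (X.As r i j t ω : ℝ) - X.As r i j s ω ≤
      ∑ i, ((X.As r i j t ω : ℝ) - X.As r i j s ω) :=
    Finset.single_le_sum (f := fun i => (X.As r i j t ω : ℝ) - X.As r i j s ω)
      (fun i _ => h0 i s t hst) (Finset.mem_univ i)
  rw [Finset.sum_sub_distrib] at h2
  simp only [h.isPath.arrivals]
  push_cast
  linarith

theorem modulus_C (h : X.IsRegularPath skill r ω K b e) (i : I) {j : J} {a f : ℝ}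
    (hA : HasModulus (fun t => (X.A r j t ω : ℝ)) K a f) :
    HasModulus (fun t => (X.C r i j t ω : ℝ)) K
      (a + Fintype.card J * ((2 * b + 1) * X.total r))
      (f + Fintype.card J * (e * √(X.total r : ℝ))) := by
  refine (hA.add (HasModulus.sum (h.modulus_D i))).of_le
    (fun s t hst => sub_nonneg.2 (by exact_mod_cast h.isPath.mono_C i j hst)) fun s t hst => ?_
  have := h.isPath.C_sub_le h.monotone_D h.isPath.monotone_A i j hst
  rw [Finset.sum_sub_distrib] at this
  linarith

theorem modulus_Q (h : X.IsRegularPath skill r ω K b e) {j : J} {a f : ℝ}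
    (hA : HasModulus (fun t => (X.A r j t ω : ℝ)) K a f) :
    HasModulus (fun t => (X.Q r j t ω : ℝ)) K
      (a + Fintype.card I * (a + Fintype.card J * ((2 * b + 1) * X.total r)))
      (f + Fintype.card I * (f + Fintype.card J * (e * √(X.total r : ℝ)))) := by
  have h1 := (h.modulus_Aq hA).add (HasModulus.sum fun i => h.modulus_C i hA).neg
  intro s t hst ht
  have h2 := h1 s t hst ht
  have q1 : (X.Q r j t ω : ℝ) + ∑ i, (X.C r i j t ω : ℝ) = X.Q r j 0 ω + X.Aq r j t ω := by
    exact_mod_cast h.isPath.queue j t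
  have q2 : (X.Q r j s ω : ℝ) + ∑ i, (X.C r i j s ω : ℝ) = X.Q r j 0 ω + X.Aq r j s ω := by
    exact_mod_cast h.isPath.queue j s
  refine le_of_eq_of_le ?_ h2
  congr 1
  linarith

theorem modulus_Z (h : X.IsRegularPath skill r ω K b e) (i : I) {j : J} {a f : ℝ}
    (hA : HasModulus (fun t => (X.A r j t ω : ℝ)) K a f) :
    HasModulus (fun t => (X.Z r i j t ω : ℝ)) K
      (a + (a + Fintype.card J * ((2 * b + 1) * X.total r)) + (2 * b + 1) * X.total r)
      (f + (f + Fintype.card J * (e * √(X.total r : ℝ))) + e * √(X.total r : ℝ)) := by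
  have h1 := ((h.modulus_As i hA).add (h.modulus_C i hA)).add (h.modulus_D i j).neg
  intro s t hst ht
  have h2 := h1 s t hst ht
  have b1 : (X.Z r i j t ω : ℝ) + X.D r i j t ω =
      X.Z r i j 0 ω + X.As r i j t ω + X.C r i j t ω := by
    exact_mod_cast h.isPath.busy i j t
  have b2 : (X.Z r i j s ω : ℝ) + X.D r i j s ω =
      X.Z r i j 0 ω + X.As r i j s ω + X.C r i j s ω := by
    exact_mod_cast h.isPath.busy i j s
  refine le_of_eq_of_le ?_ h2
  congr 1
  linarith

theorem modulus_T (h : X.IsRegularPath skill r ω K b e) (i : I) (j : J) :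
    HasModulus (fun t => X.T r i j t ω) K (1 * X.total r) 0 := by
  intro s t hst ht
  have h1 := h.isPath.T_sub_mem i j hst
  rw [abs_of_nonneg h1.1, add_zero, one_mul]
  refine h1.2.trans (mul_le_mul_of_nonneg_right ?_ (sub_nonneg.2 hst))
  exact_mod_cast X.n_le_total r i

/-- A busy indicator may jump arbitrarily often, so it has no useful slope; its oscillation 1 is
negligible against √n. -/
theorem modulus_B (h : X.IsRegularPath skill r ω K b e) (i : I) (j : J) (k : Fin (X.n r i)) :
    HasModulus (fun t => (X.B r i j k t ω : ℝ)) K 0 1 := by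
  intro s t hst ht
  have h1 : (X.B r i j k t ω : ℝ) ≤ 1 := by exact_mod_cast h.isPath.B_le_one i j k t
  have h2 : (X.B r i j k s ω : ℝ) ≤ 1 := by exact_mod_cast h.isPath.B_le_one i j k s
  have h3 : (0 : ℝ) ≤ X.B r i j k t ω := Nat.cast_nonneg _
  have h4 : (0 : ℝ) ≤ X.B r i j k s ω := Nat.cast_nonneg _
  rw [abs_le]
  constructor <;> linarith

end IsRegularPath

/-! ### Hydrodynamic scaling of moduli of continuity -/

section Scaling

variable {xs : I → J → ℝ} {r m : ℕ} {ω : Ω}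

theorem sqrt_total_le_sqrt_scaleFactor (X : SystemSeq I J Ω) (xs : I → J → ℝ) (r m : ℕ) (ω : Ω) :
    √(X.total r : ℝ) ≤ √(X.scaleFactor xs r m ω) :=
  Real.sqrt_le_sqrt (le_max_right _ _)

/-- This crude bound, from Z ≤ n, confines all scaled windows to one horizon that depends on neither
r nor m. -/
theorem sqrt_scaleFactor_le (h : X.IsPath skill r ω) (hn : 1 ≤ X.total r) :
    √(X.scaleFactor xs r m ω) ≤ (1 + ‖xs‖) * X.total r := by
  have hn1 : (1 : ℝ) ≤ X.total r := Nat.one_le_cast.2 hn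
  have hx : 0 ≤ ‖xs‖ := norm_nonneg _
  refine Real.sqrt_le_iff.2 ⟨by positivity, max_le ?_ ?_⟩
  · refine pow_le_pow_left₀ (norm_nonneg _) ?_ 2
    refine (pi_norm_le_iff_of_nonneg (by positivity)).2 fun i =>
      (pi_norm_le_iff_of_nonneg (by positivity)).2 fun j => ?_
    refine (norm_sub_le _ _).trans ?_
    have h1 : ((X.Z r i j (m / √(X.total r : ℝ)).toNNReal ω : ℕ) : ℝ) ≤ X.total r := by
      exact_mod_cast (h.Z_le i j _).trans (X.n_le_total r i)
    have h2 : (X.n r i : ℝ) ≤ X.total r := by exact_mod_cast X.n_le_total r i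
    have h3 : ‖xs i j‖ ≤ ‖xs‖ := (norm_le_pi_norm (xs i) j).trans (norm_le_pi_norm xs i)
    rw [norm_mul, Real.norm_natCast, Real.norm_natCast, add_mul, one_mul]
    exact add_le_add h1 (mul_le_mul h3 h2 (Nat.cast_nonneg _) hx)
  · have h1 : (1 : ℝ) ≤ (1 + ‖xs‖) ^ 2 := one_le_pow₀ (by linarith)
    rw [mul_pow]
    nlinarith

theorem coe_scaledTime {t : ℝ} (ht : 0 ≤ t) :
    (X.scaledTime xs r m ω t : ℝ) =
      √(X.scaleFactor xs r m ω) * t / X.total r + m / √(X.total r : ℝ) :=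
  Real.coe_toNNReal _ (by positivity)

theorem scaledTime_zero : X.scaledTime xs r m ω 0 = (m / √(X.total r : ℝ)).toNNReal := by
  simp [scaledTime]

theorem scaledTime_mono {t₁ t₂ : ℝ} (h : t₁ ≤ t₂) :
    X.scaledTime xs r m ω t₁ ≤ X.scaledTime xs r m ω t₂ := by
  refine Real.toNNReal_le_toNNReal ?_
  gcongr

theorem scaledTime_le (h : X.IsPath skill r ω) (hn : 1 ≤ X.total r) {L T t : ℝ} (hL : 0 ≤ L)
    (htL : t ≤ L) (hm : (m : ℝ) < √(X.total r : ℝ) * T) :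
    X.scaledTime xs r m ω t ≤ ((1 + ‖xs‖) * L + T).toNNReal := by
  have hn1 : (1 : ℝ) ≤ X.total r := Nat.one_le_cast.2 hn
  have hs : 0 < √(X.total r : ℝ) := Real.sqrt_pos.2 (by linarith)
  refine Real.toNNReal_le_toNNReal (add_le_add ?_ ?_)
  · rw [div_le_iff₀ (by linarith)]
    calc √(X.scaleFactor xs r m ω) * t ≤ √(X.scaleFactor xs r m ω) * L := by gcongr
      _ ≤ (1 + ‖xs‖) * X.total r * L := by
        gcongr
        exact sqrt_scaleFactor_le h hn
      _ = _ := by ring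
  · rw [div_le_iff₀ hs]
    linarith

/-- A modulus of continuity carries over to the hydrodynamic scale. -/
theorem norm_scaled_sub_le (h : X.IsPath skill r ω) (hn : 1 ≤ X.total r) {L T : ℝ} (hL : 0 ≤ L)
    (hm : (m : ℝ) < √(X.total r : ℝ) * T) {F : ℝ≥0 → ℝ} {a e : ℝ} (he : 0 ≤ e)
    (hF : HasModulus F ((1 + ‖xs‖) * L + T).toNNReal (a * X.total r) (e * √(X.total r : ℝ)))
    {t₁ t₂ : ℝ} (h1 : 0 ≤ t₁) (h12 : t₁ ≤ t₂) (h2 : t₂ ≤ L) :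
    ‖(F (X.scaledTime xs r m ω t₂) - F (X.scaledTime xs r m ω t₁)) / √(X.scaleFactor xs r m ω)‖ ≤
      a * (t₂ - t₁) + e := by
  have hn1 : (1 : ℝ) ≤ X.total r := Nat.one_le_cast.2 hn
  have hs : 0 < √(X.total r : ℝ) := Real.sqrt_pos.2 (by linarith)
  have hsx := sqrt_total_le_sqrt_scaleFactor X xs r m ω
  rw [norm_div, Real.norm_eq_abs, Real.norm_of_nonneg (Real.sqrt_nonneg _),
    div_le_iff₀ (hs.trans_le hsx)]
  refine (hF _ _ (scaledTime_mono h12) (scaledTime_le h hn hL h2 hm)).trans ?_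
  rw [coe_scaledTime h1, coe_scaledTime (h1.trans h12), add_mul]
  -- The slope part is an identity, since the window has length √x (t₂ - t₁) / n; the error part
  -- uses √n ≤ √x.
  refine add_le_add (le_of_eq ?_) (mul_le_mul_of_nonneg_left hsx he)
  field_simp
  ring

end Scaling

end SystemSeq

namespace SystemSeq

variable {I J Ω : Type*} {X : SystemSeq I J Ω} [Fintype I] [Fintype J] {skill : I → J → Prop}
  {p q : I → J → ℝ}

/-! ### Regular paths are typical -/

section Typical

variable [MeasurableSpace Ω] {P : Measure Ω} [IsProbabilityMeasure P]

theorem IsParallelRandomServer.tendsto_measure_A_deviation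
    (hX : X.IsParallelRandomServer skill p q P) (htot : Tendsto X.total atTop atTop)
    {j : J} {l : ℝ} (hrate : Tendsto (fun r => (X.rate r j : ℝ) / X.total r) atTop (𝓝 l))
    {η : ℝ} (hη : 0 < η) (K : ℝ≥0) :
    Tendsto (fun r => P {ω | ∃ s t : ℝ≥0, s ≤ t ∧ t ≤ K ∧
      η * (X.rate r j * (t - s)) + η * √(X.total r : ℝ) <
        |((X.A r j t ω : ℝ) - X.A r j s ω) - X.rate r j * (t - s)|}) atTop (𝓝 0) := by
  have hlim := ((hX.renewal j).tendsto_measure_renewalCount_deviation hη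
    -- The time change by the arrival rate maps [0, K] into [0, (|l| + 1)(K + 1) n] for large r; the
    -- added ones keep the constant positive.
    (show 0 < (|l| + 1) * (K + 1) by positivity)).comp htot
  refine tendsto_of_tendsto_of_tendsto_of_le_of_le' tendsto_const_nhds hlim
    (.of_forall fun _ => zero_le) ?_
  filter_upwards [htot.eventually_ge_atTop 1, hrate.eventually_le_const
    (show l < |l| + 1 by linarith [le_abs_self l])] with r hr hl
  have hn1 : (1 : ℝ) ≤ X.total r := Nat.one_le_cast.2 hr
  rw [div_le_iff₀ (by linarith)] at hl
  refine measure_mono ?_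
  rintro ω ⟨s, t, hst, ht, h⟩
  refine ⟨X.rate r j * s, X.rate r j * t, mul_le_mul_right hst _, ?_, ?_⟩
  · have ht' : (t : ℝ) ≤ K := ht
    push_cast
    calc (X.rate r j : ℝ) * t ≤ ((|l| + 1) * X.total r) * (K + 1) := by
          gcongr
          linarith
      _ = _ := by ring
  · push_cast
    rw [← mul_sub]
    exact h

theorem IsParallelRandomServer.tendsto_measure_not_isRegularPath
    (hX : X.IsParallelRandomServer skill p q P) (htot : Tendsto X.total atTop atTop)
    {lam : J → ℝ} (hrate : ∀ j, Tendsto (fun r => (X.rate r j : ℝ) / X.total r) atTop (𝓝 (lam j)))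
    {e : ℝ} (he : 0 < e) (K : ℝ≥0) :
    Tendsto (fun r => P {ω | ¬ X.IsRegularPath skill r ω K ‖q‖ e}) atTop (𝓝 0) := by
  have hq : ∀ i j, q i j ≤ ‖q‖₊ := fun i j =>
    (Real.le_norm_self _).trans ((norm_le_pi_norm (q i) j).trans (norm_le_pi_norm q i))
  have h1 := tendsto_finsetSum Finset.univ fun j _ =>
    hX.tendsto_measure_A_deviation htot (hrate j) he K
  have h2 := tendsto_finsetSum (Finset.univ : Finset (I × J)) fun a _ =>
    hX.tendsto_measure_D_deviation htot (hq a.1 a.2) he K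
  have h3 := h1.add h2
  simp only [Finset.sum_const_zero, add_zero] at h3
  refine tendsto_of_tendsto_of_tendsto_of_le_of_le tendsto_const_nhds h3
    (fun _ => zero_le) fun r => ?_
  refine le_trans (measure_mono_ae ?_) ((measure_union_le _ _).trans
    (add_le_add (measure_biUnion_finset_le Finset.univ _)
      (measure_biUnion_finset_le Finset.univ _)))
  filter_upwards [hX.path r, hX.ae_monotone_D r] with ω hp hm hω
  by_contra hnot
  refine hω ⟨hp, hm, fun j s t hst ht => ?_, fun i j s t hst ht => ?_⟩
  · by_contra h
    exact hnot (.inl (Set.mem_iUnion₂.2 ⟨j, Finset.mem_univ _, s, t, hst, ht, not_le.1 h⟩))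
  · by_contra h
    exact hnot (.inr (Set.mem_iUnion₂.2 ⟨(i, j), Finset.mem_univ _, s, t, hst, ht, not_le.1 h⟩))

end Typical

/-! ### Consequences for the scaled processes -/

section Consequences

variable {xs : I → J → ℝ} {r m : ℕ} {ω : Ω} {b e L T : ℝ}

theorem IsRegularPath.norm_hydroA_sub_le
    (h : X.IsRegularPath skill r ω ((1 + ‖xs‖) * L + T).toNNReal b e) (hn : 1 ≤ X.total r)
    (hL : 0 ≤ L) (hm : (m : ℝ) < √(X.total r : ℝ) * T) (he : 0 ≤ e) {N₁ : ℝ}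
    (hrate : ∀ j, 2 * X.rate r j ≤ N₁ * X.total r) (hN₁ : 0 ≤ N₁) {t : ℝ}
    (ht : t ∈ Set.Icc 0 L) :
    ‖X.hydroA xs r m t ω - fun j => (X.rate r j : ℝ) / X.total r * t‖ ≤ e * (N₁ * L + 1) := by
  have hn1 : (1 : ℝ) ≤ X.total r := Nat.one_le_cast.2 hn
  have hs : 0 < √(X.total r : ℝ) := Real.sqrt_pos.2 (by linarith)
  have hsx := sqrt_total_le_sqrt_scaleFactor X xs r m ω
  have hx := hs.trans_le hsx
  refine (pi_norm_le_iff_of_nonneg (by positivity)).2 fun j => ?_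
  have h1 := h.abs_A_le j _ _ (scaledTime_mono (xs := xs) (m := m) ht.1)
    (scaledTime_le h.isPath hn hL ht.2 hm)
  rw [coe_scaledTime ht.1, coe_scaledTime le_rfl] at h1
  have h2 : √(X.scaleFactor xs r m ω) * t / X.total r + m / √(X.total r : ℝ) -
      (√(X.scaleFactor xs r m ω) * 0 / X.total r + m / √(X.total r : ℝ)) =
      √(X.scaleFactor xs r m ω) * t / X.total r := by ring
  rw [h2, scaledTime_zero] at h1
  have h3 : X.hydroA xs r m t ω j - (X.rate r j : ℝ) / X.total r * t =
      (((X.A r j (X.scaledTime xs r m ω t) ω : ℝ) -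
        X.A r j (m / √(X.total r : ℝ)).toNNReal ω) -
        X.rate r j * (√(X.scaleFactor xs r m ω) * t / X.total r)) /
        √(X.scaleFactor xs r m ω) := by
    rw [hydroA, hydro]
    field_simp
  rw [Pi.sub_apply, h3, norm_div, Real.norm_eq_abs, Real.norm_of_nonneg hx.le, div_le_iff₀ hx]
  refine h1.trans ?_
  have h4 : (X.rate r j : ℝ) * (√(X.scaleFactor xs r m ω) * t / X.total r) ≤
      N₁ * L * √(X.scaleFactor xs r m ω) := by
    rw [mul_div_assoc', div_le_iff₀ (by linarith)]
    have h5 : (X.rate r j : ℝ) ≤ N₁ * X.total r := by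
      have := hrate j
      have := (X.rate r j).2
      linarith
    calc (X.rate r j : ℝ) * (√(X.scaleFactor xs r m ω) * t)
        ≤ (N₁ * X.total r) * (√(X.scaleFactor xs r m ω) * L) := by
          have := ht.2
          have := ht.1
          gcongr
      _ = _ := by ring
  calc _ ≤ e * (N₁ * L * √(X.scaleFactor xs r m ω)) + e * √(X.scaleFactor xs r m ω) := by
        gcongr
    _ = _ := by ring

theorem IsRegularPath.norm_hydroD_sub_le
    (h : X.IsRegularPath skill r ω ((1 + ‖xs‖) * L + T).toNNReal b e) (hn : 1 ≤ X.total r)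
    (hL : 0 ≤ L) (hm : (m : ℝ) < √(X.total r : ℝ) * T) (he : 0 ≤ e) (hb : 0 ≤ b) {t₁ t₂ : ℝ}
    (h1 : 0 ≤ t₁) (h12 : t₁ ≤ t₂) (h2 : t₂ ≤ L) :
    ‖X.hydroD xs r m t₂ ω - X.hydroD xs r m t₁ ω‖ ≤ (2 * b + 1) * (t₂ - t₁) + e := by
  have h0 : 0 ≤ (2 * b + 1) * (t₂ - t₁) + e := by
    have := sub_nonneg.2 h12
    positivity
  refine (pi_norm_le_iff_of_nonneg h0).2 fun i => (pi_norm_le_iff_of_nonneg h0).2 fun j => ?_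
  refine le_of_eq_of_le ?_ (norm_scaled_sub_le (xs := xs) (m := m) h.isPath hn hL hm he
    (h.modulus_D i j) h1 h12 h2)
  simp only [hydroD, hydro, Pi.sub_apply]
  congr 1
  ring

/-- The Lipschitz constant of the hydrodynamic limits, in terms of bounds `N₁` and `N₀` for the
rates of arrivals and departures. -/
def hydroLipschitz (I J : Type*) [Fintype I] [Fintype J] (N₁ N₀ : ℝ) : ℝ :=
  N₁ + (Fintype.card I + 1) * (N₁ + Fintype.card J * N₀) + N₀ + 1

/-- The Lipschitz constant must dominate the slopes of all components; those of Q, N₁ + |I|(N₁ +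
|J|N₀), and Z, 2N₁ + |J|N₀ + N₀, dictate its form, with N₀ = 2b + 1. The factor in `hε` does the
same for the errors, and `hεn` pays for the unit jumps of B. -/
theorem IsRegularPath.norm_hydroX_sub_le
    (h : X.IsRegularPath skill r ω ((1 + ‖xs‖) * L + T).toNNReal b e) (hn : 1 ≤ X.total r)
    (hL : 0 ≤ L) (hm : (m : ℝ) < √(X.total r : ℝ) * T) (he : 0 ≤ e) (he1 : e ≤ 1) (hb : 0 ≤ b)
    {N₁ : ℝ} (hrate : ∀ j, 2 * X.rate r j ≤ N₁ * X.total r) (hN₁ : 0 ≤ N₁) {ε : ℝ}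
    (hε : e * (3 + (Fintype.card I + 1) * (1 + Fintype.card J)) ≤ ε)
    (hεn : 1 ≤ ε * √(X.total r : ℝ)) {t₁ t₂ : ℝ}
    (h1 : 0 ≤ t₁) (h12 : t₁ ≤ t₂) (h2 : t₂ ≤ L) :
    ‖X.hydroX xs r m t₂ ω - X.hydroX xs r m t₁ ω‖ ≤
      hydroLipschitz I J N₁ (2 * b + 1) * (t₂ - t₁) + ε := by
  have hε0 : 0 ≤ ε := le_trans (by positivity) hε
  set N := hydroLipschitz I J N₁ (2 * b + 1) with hN
  set c : ℝ := (Fintype.card I : ℝ)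
  set d : ℝ := (Fintype.card J : ℝ)
  have hc : 0 ≤ c := Nat.cast_nonneg _
  have hd : 0 ≤ d := Nat.cast_nonneg _
  have hN' : N = N₁ + (c + 1) * (N₁ + d * (2 * b + 1)) + (2 * b + 1) + 1 := rfl
  have hdb : 0 ≤ d * (2 * b + 1) := by positivity
  have hcdb : 0 ≤ c * (N₁ + d * (2 * b + 1)) := by positivity
  have hed : 0 ≤ e * d := by positivity
  have hced : 0 ≤ e * (c * (1 + d)) := by positivity
  have h0 : 0 ≤ N * (t₂ - t₁) + ε := by
    have := sub_nonneg.2 h12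
    have : 0 ≤ N := by
      rw [hN']
      positivity
    positivity
  have hmod : ∀ {F : ℝ≥0 → ℝ} {a f : ℝ}, HasModulus F ((1 + ‖xs‖) * L + T).toNNReal a f →
      a ≤ N * X.total r → f ≤ ε * √(X.total r : ℝ) →
      ‖(F (X.scaledTime xs r m ω t₂) - F (X.scaledTime xs r m ω t₁)) /
        √(X.scaleFactor xs r m ω)‖ ≤ N * (t₂ - t₁) + ε := fun hF ha hf =>
    norm_scaled_sub_le h.isPath hn hL hm hε0 (hF.mono ha hf) h1 h12 h2
  have hA := fun j => h.modulus_A he1 (hrate j)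
  have hle : ∀ {a : ℝ}, a ≤ N → a * X.total r ≤ N * X.total r := fun ha =>
    mul_le_mul_of_nonneg_right ha (Nat.cast_nonneg _)
  have hle' : ∀ {f : ℝ}, f ≤ ε → f * √(X.total r : ℝ) ≤ ε * √(X.total r : ℝ) := fun hf =>
    mul_le_mul_of_nonneg_right hf (Real.sqrt_nonneg _)
  have kA := fun j => hmod (hA j) (hle (by linarith)) (hle' (by linarith))
  have kAs := fun i j => hmod (h.modulus_As i (hA j)) (hle (by linarith)) (hle' (by linarith))
  have kAq := fun j => hmod (h.modulus_Aq (hA j)) (hle (by linarith)) (hle' (by linarith))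
  have kQ := fun j => hmod (h.modulus_Q (hA j))
    ((le_of_eq (by ring)).trans (hle (a := N₁ + c * (N₁ + d * (2 * b + 1))) (by linarith)))
    ((le_of_eq (by ring)).trans (hle' (f := e * (1 + c * (1 + d))) (by linarith)))
  have kB := fun i j k => hmod (h.modulus_B i j k)
    ((le_of_eq (zero_mul _).symm).trans (hle (by linarith))) hεn
  have kZ := fun i j => hmod (h.modulus_Z i (hA j))
    ((le_of_eq (by ring)).trans (hle (a := N₁ + (N₁ + d * (2 * b + 1)) + (2 * b + 1))
      (by linarith)))
    ((le_of_eq (by ring)).trans (hle' (f := e * (3 + d)) (by linarith)))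
  have kC := fun i j => hmod (h.modulus_C i (hA j))
    ((le_of_eq (by ring)).trans (hle (a := N₁ + d * (2 * b + 1)) (by linarith)))
    ((le_of_eq (by ring)).trans (hle' (f := e * (1 + d)) (by linarith)))
  have kT := fun i j => hmod (h.modulus_T i j) (hle (by linarith)) (by positivity)
  have kD := fun i j => hmod (h.modulus_D i j) (hle (by linarith)) (hle' (by linarith))
  simp only [hydroX, Prod.mk_sub_mk, norm_prod_le_iff, pi_norm_le_iff_of_nonneg h0, Pi.sub_apply,
    hydroA, hydroAs, hydroAq, hydroQ, hydroB, hydroZ, hydroC, hydroT, hydroD, hydro]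
  refine ⟨fun j => ?_, fun i j => ?_, fun j => ?_, fun j => ?_, fun i j k => ?_, fun i j => ?_,
    fun i j => ?_, fun i j => ?_, fun i j => ?_⟩
  · refine le_of_eq_of_le ?_ (kA j)
    congr 1; ring
  · refine le_of_eq_of_le ?_ (kAs i j)
    congr 1; ring
  · refine le_of_eq_of_le ?_ (kAq j)
    congr 1; ring
  · refine le_of_eq_of_le ?_ (kQ j)
    congr 1; ring
  · refine le_of_eq_of_le ?_ (kB i j k)
    congr 1; ring
  · refine le_of_eq_of_le ?_ (kZ i j)
    congr 1; ring
  · refine le_of_eq_of_le ?_ (kC i j)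
    congr 1; ring
  · refine le_of_eq_of_le ?_ (kT i j)
    congr 1; ring
  · refine le_of_eq_of_le ?_ (kD i j)
    congr 1; ring

end Consequences

end SystemSeq

/-! ### Service times of a single server -/

theorem jumpTime_le {Ω : Type*} {S : ℝ≥0 → Ω → ℕ} {m : ℕ} {t : ℝ≥0} {ω : Ω} (h : m ≤ S t ω) :
    jumpTime S m ω ≤ t :=
  csInf_le' h

theorem jumpTime_zero {Ω : Type*} (S : ℝ≥0 → Ω → ℕ) (ω : Ω) : jumpTime S 0 ω = 0 :=
  le_antisymm (jumpTime_le (Nat.zero_le _)) zero_le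

namespace IsStdPoissonProcess

variable {Ω : Type*} [MeasurableSpace Ω] {P : Measure Ω} {S : ℝ≥0 → Ω → ℕ}

theorem measure_le_le [IsProbabilityMeasure P] (hS : IsStdPoissonProcess P S) (a : ℝ≥0) (z : ℝ) :
    P {ω | z ≤ S a ω} ≤ ENNReal.ofReal (Real.exp (a * (Real.exp 1 - 1) - z)) := by
  have := measure_le_sum_poisson (Y := fun (_ : Unit) ω => S (0 + a) ω - S 0 ω) (P := P)
    (fun _ => (hS.measurable _).sub (hS.measurable _)) iIndepFun.of_subsingleton
    (fun _ => hS.law 0 a) Finset.univ z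
  simpa [hS.zero] using this

theorem measure_increment_eq_zero (hS : IsStdPoissonProcess P S) (a y : ℝ≥0) :
    P {ω | S (a + y) ω ≤ S a ω} = ENNReal.ofReal (Real.exp (-y)) := by
  have h1 : {ω | S (a + y) ω ≤ S a ω} = (fun ω => S (a + y) ω - S a ω) ⁻¹' {0} := by
    ext ω
    simp [tsub_eq_zero_iff_le]
  have hm : Measurable fun ω => S (a + y) ω - S a ω := (hS.measurable _).sub (hS.measurable _)
  rw [h1, ← Measure.map_apply hm (measurableSet_singleton _), hS.law, poissonMeasure_singleton]
  simp

end IsStdPoissonProcess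

namespace SystemSeq

variable {I J Ω : Type*} {X : SystemSeq I J Ω}

theorem V_eq (X : SystemSeq I J Ω) (i : I) (j : J) (k m : ℕ) (ω : Ω) :
    X.V i j k m ω = jumpTime (X.S i j k) m ω / X.μ i j k ω := by
  simp only [V, interJumpTime]
  rw [← Finset.sum_div, Finset.sum_range_sub (fun l => (jumpTime (X.S i j k) l ω : ℝ)),
    jumpTime_zero, NNReal.coe_zero, sub_zero]

/-- No cancellation is used: both jump times lie in [0, a + y] and both counts in [0, z]. A jump in
(a, a + y] is required because the offsets `b₁`, `b₂` may point to the jump after the last one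
counted. -/
theorem abs_V_sub_le {i : I} {j : J} {k : ℕ} {ω : Ω} {a y : ℝ≥0} {z p : ℝ} (hp : 0 < p)
    (hμ : p ≤ X.μ i j k ω) (hy : X.S i j k a ω < X.S i j k (a + y) ω)
    (hz : (X.S i j k a ω : ℝ) ≤ z) {d₁ d₂ b₁ b₂ : ℕ} (hd₁ : d₁ ≤ X.S i j k a ω)
    (hd₂ : d₂ ≤ X.S i j k a ω) (hb₁ : b₁ ≤ 1) (hb₂ : b₂ ≤ 1) :
    |X.V i j k (d₂ + b₁) ω - X.V i j k (d₁ + b₂) ω - 1 / X.μ i j k ω * (d₂ - d₁)| ≤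
      (a + y + z) / p := by
  have hμ0 : 0 < X.μ i j k ω := hp.trans_le hμ
  have h1 : (jumpTime (X.S i j k) (d₂ + b₁) ω : ℝ) ≤ a + y := by
    have : d₂ + b₁ ≤ X.S i j k (a + y) ω := by omega
    exact_mod_cast jumpTime_le this
  have h2 : (jumpTime (X.S i j k) (d₁ + b₂) ω : ℝ) ≤ a + y := by
    have : d₁ + b₂ ≤ X.S i j k (a + y) ω := by omega
    exact_mod_cast jumpTime_le this
  have h3 : (0 : ℝ) ≤ jumpTime (X.S i j k) (d₂ + b₁) ω := NNReal.coe_nonneg _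
  have h4 : (0 : ℝ) ≤ jumpTime (X.S i j k) (d₁ + b₂) ω := NNReal.coe_nonneg _
  have h5 : (d₁ : ℝ) ≤ z := le_trans (by exact_mod_cast hd₁) hz
  have h6 : (d₂ : ℝ) ≤ z := le_trans (by exact_mod_cast hd₂) hz
  have h7 : (0 : ℝ) ≤ d₁ := Nat.cast_nonneg _
  have h8 : (0 : ℝ) ≤ d₂ := Nat.cast_nonneg _
  have h9 : (0 : ℝ) ≤ a + y := by positivity
  rw [V_eq, V_eq, ← sub_div, one_div, ← div_eq_inv_mul, ← sub_div, abs_div, abs_of_pos hμ0]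
  refine div_le_div₀ (by linarith) ?_ hp hμ
  rw [abs_le]
  constructor <;> linarith

theorem tendsto_total_atTop [Fintype I] {X : SystemSeq I J Ω} {j : J} {l : ℝ} (hl : 0 < l)
    (h1 : Tendsto (fun r => (X.rate r j : ℝ)) atTop atTop)
    (h2 : Tendsto (fun r => (X.rate r j : ℝ) / X.total r) atTop (𝓝 l)) :
    Tendsto X.total atTop atTop := by
  refine (tendsto_natCast_atTop_iff (R := ℝ)).1 ?_
  have h3 := h1.atTop_mul_pos (inv_pos.2 hl) (h2.inv₀ hl.ne')
  refine tendsto_atTop_mono' _ ?_ h3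
  filter_upwards with r
  rw [inv_div]
  -- Where the rate vanishes, the comparison sequence takes the value 0 by division by zero and is
  -- still a lower bound.
  by_cases h : (X.rate r j : ℝ) = 0
  · simp [h]
  · rw [mul_div_cancel₀ _ h]

variable [Fintype I] [Fintype J] [MeasurableSpace Ω] {P : Measure Ω} [IsProbabilityMeasure P]
  {skill : I → J → Prop} {p q : I → J → ℝ}

/-- The clock of a server stays below ‖q‖K, and all the Poisson processes have the same law, so the
bound on service times and counts is independent of r and of the server; √n eventually exceeds it.
-/
theorem IsParallelRandomServer.eventually_measure_hydroV_le
    (hX : X.IsParallelRandomServer skill p q P) (htot : Tendsto X.total atTop atTop)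
    (xs : I → J → ℝ) {ε L T : ℝ} (hε : 0 < ε) (hL : 0 < L) {i : I} {j : J}
    (hij : skill i j) :
    ∀ᶠ r : ℕ in atTop, ∀ k : Fin (X.n r i), ∀ b ∈ ({(1, 0), (0, 1)} : Set (ℕ × ℕ)),
      P {ω | ∃ m : ℕ, (m : ℝ) < √(X.total r : ℝ) * T ∧ ∃ t ∈ Set.Icc 0 L,
        ε < |X.hydroV xs r m i j k b t ω -
          1 / X.μ i j k ω * X.hydroServerD xs r m i j k t ω|} ≤ ENNReal.ofReal ε := by
  set K : ℝ≥0 := ((1 + ‖xs‖) * L + T).toNNReal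
  set a : ℝ≥0 := ‖q‖₊ * K
  have hq : q i j ≤ ‖q‖₊ :=
    (Real.le_norm_self _).trans ((norm_le_pi_norm (q i) j).trans (norm_le_pi_norm q i))
  have hpij := hX.p_pos i j hij
  obtain ⟨y, hy⟩ : ∃ y : ℝ≥0, Real.exp (-y) ≤ ε / 2 := by
    have h1 : Tendsto (fun y : ℝ≥0 => Real.exp (-(y : ℝ))) atTop (𝓝 0) :=
      Real.tendsto_exp_neg_atTop_nhds_zero.comp (NNReal.tendsto_coe_atTop.2 tendsto_id)
    exact (h1.eventually_le_const (by positivity)).exists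
  -- With this z the Chernoff bound for the number of jumps up to a equals exp(-y), the same as the
  -- probability of no jump in (a, a + y].
  set z : ℝ := a * (Real.exp 1 - 1) + y
  have hn : Tendsto (fun r => ε * √(X.total r : ℝ)) atTop atTop :=
    (Real.tendsto_sqrt_atTop.comp (tendsto_natCast_atTop_atTop.comp htot)).const_mul_atTop hε
  filter_upwards [htot.eventually_ge_atTop 1, hn.eventually_ge_atTop ((a + y + z) / p i j)]
    with r hr hr2 k b hb
  have hn1 : (1 : ℝ) ≤ X.total r := Nat.one_le_cast.2 hr
  have hs : 0 < √(X.total r : ℝ) := Real.sqrt_pos.2 (by linarith)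
  have hS := hX.poisson i j k
  have hPz : P {ω | z ≤ X.S i j k a ω} ≤ ENNReal.ofReal (ε / 2) := by
    refine (hS.measure_le_le a z).trans (ENNReal.ofReal_le_ofReal ?_)
    refine le_trans (le_of_eq ?_) hy
    congr 1
    simp only [z]
    ring
  have hPy : P {ω | X.S i j k (a + y) ω ≤ X.S i j k a ω} ≤ ENNReal.ofReal (ε / 2) := by
    rw [hS.measure_increment_eq_zero]
    exact ENNReal.ofReal_le_ofReal hy
  have hb1 : b.1 ≤ 1 ∧ b.2 ≤ 1 := by
    rcases hb with rfl | rfl <;> simp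
  have hε2 : ENNReal.ofReal ε = ENNReal.ofReal (ε / 2) + ENNReal.ofReal (ε / 2) := by
    rw [← ENNReal.ofReal_add (by positivity) (by positivity), add_halves]
  rw [hε2]
  refine le_trans (measure_mono_ae ?_) ((measure_union_le _ _).trans (add_le_add hPz hPy))
  filter_upwards [hX.path r, hX.ae_μ_mem] with ω hp hμ
  rintro ⟨m, hm, t, ht, hlt⟩
  by_contra hnot
  have hnz : ¬ z ≤ X.S i j k a ω := fun h => hnot (.inl h)
  have hny : ¬ X.S i j k (a + y) ω ≤ X.S i j k a ω := fun h => hnot (.inr h)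
  have hμk := hμ i j k hij
  have hD : ∀ s : ℝ≥0, s ≤ K → X.serverD r i j k s ω ≤ X.S i j k a ω := by
    intro s hsK
    refine hS.mono ω (Real.toNNReal_le_iff_le_coe.2 ?_)
    have hsK' : (s : ℝ) ≤ K := hsK
    rw [NNReal.coe_mul]
    exact mul_le_mul (hμk.2.trans hq) ((hp.serverT_le i j k s).trans hsK')
      (hp.serverT_nonneg i j k s) (NNReal.coe_nonneg _)
  have hsx := sqrt_total_le_sqrt_scaleFactor X xs r m ω
  have hx := hs.trans_le hsx
  have h0 := scaledTime_le (xs := xs) (m := m) hp hr hL.le hL.le hm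
  rw [scaledTime_zero] at h0
  have key := abs_V_sub_le hpij hμk.1 (not_le.1 hny) (not_le.1 hnz).le (hD _ h0)
    (hD _ (scaledTime_le (xs := xs) (m := m) hp hr hL.le ht.2 hm)) hb1.1 hb1.2
  refine absurd hlt (not_lt.2 ?_)
  have h1 : X.hydroV xs r m i j k b t ω - 1 / X.μ i j k ω * X.hydroServerD xs r m i j k t ω =
      (X.V i j k (X.serverD r i j k (X.scaledTime xs r m ω t) ω + b.1) ω -
        X.V i j k (X.serverD r i j k (m / √(X.total r : ℝ)).toNNReal ω + b.2) ω -
        1 / X.μ i j k ω * ((X.serverD r i j k (X.scaledTime xs r m ω t) ω : ℝ) -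
          X.serverD r i j k (m / √(X.total r : ℝ)).toNNReal ω)) /
        √(X.scaleFactor xs r m ω) := by
    rw [hydroV, hydroServerD, hydro]
    ring
  rw [h1, abs_div, abs_of_pos hx, div_le_iff₀ hx]
  exact key.trans (hr2.trans (mul_le_mul_of_nonneg_left hsx hε.le))

end SystemSeq

end RandomServer

end

theorem mainTheorem4 {I J : Type*} [Fintype I] [Fintype J] (skill : I → J → Prop)
    (β : I → ℝ) (lam : J → ℝ) (q : I → J → ℝ) :
    ∃ N : ℝ, 0 < N ∧
      ∀ (Ω : Type*) [MeasurableSpace Ω] (P : Measure Ω) [IsProbabilityMeasure P]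
        (p : I → J → ℝ) (X : RandomServer.SystemSeq I J Ω) (ρ : ℝ) (xs : I → J → ℝ),
        X.IsParallelRandomServer skill p q P →
        (∀ i, 0 < β i ∧
          Tendsto (fun r => (X.n r i : ℝ) / X.total r) atTop (𝓝 (β i))) →
        (∀ j, 0 < lam j ∧
          Tendsto (fun r => (X.rate r j : ℝ) / X.total r) atTop (𝓝 (lam j))) →
        RandomServer.IsOptimal skill β (fun i j => ∫ ω, X.μ i j 0 ω ∂P) lam ρ xs →
        ∀ ε L T : ℝ, 0 < ε → 0 < L → 0 < T → ∀ᶠ r : ℕ in atTop,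
          P {ω | ∃ m : ℕ, (m : ℝ) < √(X.total r : ℝ) * T ∧ ∃ t ∈ Set.Icc 0 L,
              ε < ‖X.hydroA xs r m t ω - fun j => (X.rate r j : ℝ) / X.total r * t‖}
            ≤ ENNReal.ofReal ε ∧
          P {ω | ∃ m : ℕ, (m : ℝ) < √(X.total r : ℝ) * T ∧
              ∃ t₁ ∈ Set.Icc 0 L, ∃ t₂ ∈ Set.Icc 0 L,
              N * |t₂ - t₁| + ε < ‖X.hydroD xs r m t₂ ω - X.hydroD xs r m t₁ ω‖}
            ≤ ENNReal.ofReal ε ∧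
          (∀ i j, skill i j → ∀ k : Fin (X.n r i), ∀ b ∈ ({(1, 0), (0, 1)} : Set (ℕ × ℕ)),
            P {ω | ∃ m : ℕ, (m : ℝ) < √(X.total r : ℝ) * T ∧ ∃ t ∈ Set.Icc 0 L,
                ε < |X.hydroV xs r m i j k b t ω -
                  1 / X.μ i j k ω * X.hydroServerD xs r m i j k t ω|}
              ≤ ENNReal.ofReal ε) ∧
          P {ω | ∃ m : ℕ, (m : ℝ) < √(X.total r : ℝ) * T ∧
              ∃ t₁ t₂ : ℝ, 0 ≤ t₁ ∧ t₁ ≤ t₂ ∧ t₂ ≤ L ∧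
              N * |t₂ - t₁| + ε < ‖X.hydroX xs r m t₂ ω - X.hydroX xs r m t₁ ω‖}
            ≤ ENNReal.ofReal ε := by
  -- Eventually the rates are at most (‖lam‖ + 1) n; the factor 2 is the one demanded by
  -- `modulus_A`.
  set N₁ : ℝ := 2 * (‖lam‖ + 1) with hN₁
  have hN₁0 : 0 < N₁ := by positivity
  set N : ℝ := RandomServer.SystemSeq.hydroLipschitz I J N₁ (2 * ‖q‖ + 1) with hN
  have hNq : 2 * ‖q‖ + 1 ≤ N := by
    have : 0 ≤ N₁ + (Fintype.card I + 1) * (N₁ + Fintype.card J * (2 * ‖q‖ + 1)) := by positivity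
    rw [hN, RandomServer.SystemSeq.hydroLipschitz]
    linarith
  have hN0 : 0 < N := lt_of_lt_of_le (by positivity) hNq
  refine ⟨N, hN0, ?_⟩
  intro Ω _ P _ p X ρ xs hX _ hrate _ ε L T hε hL _
  -- Without classes nothing forces n to infinity, but all scaled processes then take values in a
  -- one-point space.
  rcases isEmpty_or_nonempty J with hJ | ⟨⟨j₀⟩⟩
  · have hnull : ∀ s : Set Ω, (∀ ω, ω ∉ s) → P s ≤ ENNReal.ofReal ε := fun s hs => by
      rw [Set.eq_empty_of_forall_notMem hs, measure_empty]
      exact zero_le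
    refine .of_forall fun r => ⟨hnull _ ?_, hnull _ ?_, fun i j => isEmptyElim j, hnull _ ?_⟩
    · rintro ω ⟨m, -, t, -, h⟩
      rw [norm_of_subsingleton] at h
      exact lt_asymm h hε
    · rintro ω ⟨m, -, t₁, -, t₂, -, h⟩
      rw [norm_of_subsingleton] at h
      have : 0 ≤ N * |t₂ - t₁| := by positivity
      linarith
    · rintro ω ⟨m, -, t₁, t₂, -, -, -, h⟩
      rw [norm_of_subsingleton] at h
      have : 0 ≤ N * |t₂ - t₁| := by positivity
      linarith
  have htot : Tendsto X.total atTop atTop := RandomServer.SystemSeq.tendsto_total_atTop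
    (hrate j₀).1 (hX.rate_atTop j₀) (hrate j₀).2
  set c : ℝ := 3 + ((Fintype.card I : ℝ) + 1) * (1 + Fintype.card J) with hc
  have hc0 : 0 < c := by positivity
  -- The three bounds serve `modulus_A`, the sum of errors in claim 4, and the drift error over [0,
  -- L] in claim 1.
  set e : ℝ := min 1 (min (ε / c) (ε / (N₁ * L + 1))) with he
  have he0 : 0 < e := by positivity
  have he1 : e ≤ 1 := min_le_left _ _
  have hec : e * c ≤ ε :=
    (le_div_iff₀ hc0).1 ((min_le_right _ _).trans (min_le_left _ _))
  have heL : e * (N₁ * L + 1) ≤ ε :=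
    (le_div_iff₀ (by positivity)).1 ((min_le_right _ _).trans (min_le_right _ _))
  have heε : e ≤ ε := by
    refine le_trans (le_mul_of_one_le_right he0.le ?_) heL
    have : 0 ≤ N₁ * L := by positivity
    linarith
  have hn : Tendsto (fun r => ε * √(X.total r : ℝ)) atTop atTop :=
    (Real.tendsto_sqrt_atTop.comp (tendsto_natCast_atTop_atTop.comp htot)).const_mul_atTop hε
  have hreg := hX.tendsto_measure_not_isRegularPath htot (fun j => (hrate j).2) he0
    ((1 + ‖xs‖) * L + T).toNNReal
  have hV : ∀ᶠ r : ℕ in atTop, ∀ i j, skill i j → ∀ k : Fin (X.n r i),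
      ∀ b ∈ ({(1, 0), (0, 1)} : Set (ℕ × ℕ)),
        P {ω | ∃ m : ℕ, (m : ℝ) < √(X.total r : ℝ) * T ∧ ∃ t ∈ Set.Icc 0 L,
          ε < |X.hydroV xs r m i j k b t ω -
            1 / X.μ i j k ω * X.hydroServerD xs r m i j k t ω|} ≤ ENNReal.ofReal ε := by
    refine eventually_all.2 fun i => eventually_all.2 fun j => ?_
    by_cases hij : skill i j
    · filter_upwards [hX.eventually_measure_hydroV_le htot xs (T := T) hε hL hij] with r h _ using h
    · exact .of_forall fun r h => absurd h hij
  have hr : ∀ᶠ r in atTop, ∀ j, (X.rate r j : ℝ) / X.total r ≤ ‖lam‖ + 1 := by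
    refine eventually_all.2 fun j => (hrate j).2.eventually_le_const ?_
    have := (Real.le_norm_self _).trans (norm_le_pi_norm lam j)
    linarith
  filter_upwards [htot.eventually_ge_atTop 1, hn.eventually_ge_atTop 1, hV, hr,
    hreg.eventually_le_const (ENNReal.ofReal_pos.2 hε)] with r hr1 hr2 hr3 hr4 hr5
  have hn1 : (1 : ℝ) ≤ X.total r := Nat.one_le_cast.2 hr1
  have hrate' : ∀ j, 2 * (X.rate r j : ℝ) ≤ N₁ * X.total r := fun j => by
    have := (div_le_iff₀ (by linarith)).1 (hr4 j)
    rw [hN₁]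
    linarith
  -- The bad events of claims 1, 2 and 4 all lie in the same set of irregular paths, so no union
  -- over m is taken.
  refine ⟨(measure_mono ?_).trans hr5, (measure_mono ?_).trans hr5, hr3,
    (measure_mono ?_).trans hr5⟩
  · rintro ω ⟨m, hm, t, ht, h⟩ hω
    exact absurd h (not_lt.2 ((hω.norm_hydroA_sub_le hr1 hL.le hm he0.le hrate' hN₁0.le ht).trans
      heL))
  · rintro ω ⟨m, hm, t₁, ht₁, t₂, ht₂, h⟩ hω
    refine absurd h (not_lt.2 ?_)
    have hq : 0 ≤ ‖q‖ := norm_nonneg _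
    refine le_trans (?_ : _ ≤ (2 * ‖q‖ + 1) * |t₂ - t₁| + e) (by gcongr)
    rcases le_total t₁ t₂ with h12 | h12
    · rw [abs_of_nonneg (sub_nonneg.2 h12)]
      exact hω.norm_hydroD_sub_le hr1 hL.le hm he0.le hq ht₁.1 h12 ht₂.2
    · rw [norm_sub_rev, abs_sub_comm, abs_of_nonneg (sub_nonneg.2 h12)]
      exact hω.norm_hydroD_sub_le hr1 hL.le hm he0.le hq ht₂.1 h12 ht₁.2
  · rintro ω ⟨m, hm, t₁, t₂, h1, h12, h2, h⟩ hω
    refine absurd h (not_lt.2 ?_)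
    rw [abs_of_nonneg (sub_nonneg.2 h12)]
    exact hω.norm_hydroX_sub_le hr1 hL.le hm he0.le he1 (norm_nonneg q) hrate' hN₁0.le hec hr2
      h1 h12 h2
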